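/- For a Riemannian manifold $(M,g)$ with Riemann curvature tensor $R$, Ricci tensor $cR$ and scalar curvature $c^2R$, let $$h_4=\|R\|^2-\|cR\|^2+\tfrac14 (c^2R)^2$$ be its second Hermann Weyl curvature invariant, a function on $M$; here, in any orthonormal basis of the tangent space, $\|R\|^2=\sum_{i<j,\,k<l}R_{ijkl}^2$ and $\|cR\|^2=\sum_{i,j}(cR)_{ij}^2$. Let $G$ be a Lie group endowed with a bi-invariant Riemannian metric $b$, and let the rank of $G$ be the dimension of a Cartan subalgebra of its Lie algebra (for compact $G$, the dimension of a maximal torus). (1) Suppose that $G$ is compact and connected with $\dim G\ge 4$. If $\operatorname{rank} G<\left[\frac{\dim G+1}{2}\right]$, then $h_4>0$ everywhere on $(G,b)$. In particular, if $G$ is simple (that is, its Lie algebra is simple), then $\operatorname{rank} G<\left[\frac{\dim G+1}{2}\right]$ and $h_4>0$ everywhere on $(G,b)$. (2) Let $H\subset G$ be a closed subgroup with $\dim (G/H)\ge 4$, and let $G/H$ carry a normal homogeneous metric, that is, a Riemannian metric for which the projection $(G,b)\to G/H$ is a Riemannian submersion. If $\operatorname{rank} G<\left[\frac{\dim (G/H)+1}{2}\right]$,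 then $h_4>0$ everywhere on $G/H$. -/

import Mathlib

open scoped Manifold ContDiff Bundle
open Bundle

noncomputable section

namespace SecondWeyl

section Riemannian

variable {E : Type*} [NormedAddCommGroup E] [NormedSpace ℝ E]
  {H : Type*} [TopologicalSpace H] (I : ModelWithCorners ℝ E H)
  {M : Type*} [TopologicalSpace M] [ChartedSpace H M] [IsManifold I ∞ M]
  [RiemannianBundle (fun x : M ↦ TangentSpace I x)]

/-- The right-hand side of the Koszul formula: for differentiable vector fields `X`, `Y`, `Z`,
this is `⟪∇_X Y, Z⟫` at `x`, where `∇` is the Levi-Civita connection. -/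
def koszul (X Y Z : Π x : M, TangentSpace I x) (x : M) : ℝ :=
  (1 / 2 : ℝ) *
    (mvfderiv I (fun y ↦ inner ℝ (Y y) (Z y)) x (X x)
      + mvfderiv I (fun y ↦ inner ℝ (X y) (Z y)) x (Y x)
      - mvfderiv I (fun y ↦ inner ℝ (X y) (Y y)) x (Z x)
      + inner ℝ (VectorField.mlieBracket I X Y x) (Z x)
      - inner ℝ (VectorField.mlieBracket I X Z x) (Y x)
      - inner ℝ (VectorField.mlieBracket I Y Z x) (X x))

open Classical in
/-- The Levi-Civita connection of a Riemannian manifold: `leviCivita I X Y` is `∇_X Y`. Its value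
at `x` is the unique tangent vector `u` such that `⟪u, z⟫` is given by the Koszul formula for
every tangent vector `z` at `x`, extended to a smooth vector field near `x`. (Such a `u` exists
whenever `X` and `Y` are differentiable at `x`; otherwise the value may be the junk value `0`.) -/
def leviCivita (X Y : Π x : M, TangentSpace I x) (x : M) : TangentSpace I x :=
  if h : ∃! u : TangentSpace I x,
      ∀ z : TangentSpace I x, inner ℝ u z = koszul I X Y (FiberBundle.extend E z) x
  then h.choose else 0

/-- The Riemann curvature operator
`R(u, v) w = ∇_u ∇_v w - ∇_v ∇_u w - ∇_[u, v] w` at `x`, computed with smooth vector fields near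
`x` that extend the tangent vectors `u`, `v`, `w`. -/
def curvature {x : M} (u v w : TangentSpace I x) : TangentSpace I x :=
  let U : Π y : M, TangentSpace I y := FiberBundle.extend E u
  let V : Π y : M, TangentSpace I y := FiberBundle.extend E v
  let W : Π y : M, TangentSpace I y := FiberBundle.extend E w
  leviCivita I U (leviCivita I V W) x - leviCivita I V (leviCivita I U W) x
    - leviCivita I (VectorField.mlieBracket I U V) W x

variable [FiniteDimensional ℝ E]

instance (x : M) : FiniteDimensional ℝ (TangentSpace I x) :=
  inferInstanceAs (FiniteDimensional ℝ E)

/-- The Ricci curvature `cR(v, w)`, the contraction of the Riemann curvature tensor. -/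
def ricci {x : M} (v w : TangentSpace I x) : ℝ :=
  let e := stdOrthonormalBasis ℝ (TangentSpace I x)
  ∑ i, inner ℝ (curvature I (e i) v w) (e i)

/-- The scalar curvature `c²R` at `x`, the contraction of the Ricci curvature. -/
def scalarCurvature (x : M) : ℝ :=
  let e := stdOrthonormalBasis ℝ (TangentSpace I x)
  ∑ i, ricci I (e i) (e i)

/-- `‖R‖²` at `x`, where the curvature tensor is regarded as a bilinear form on 2-vectors; the
2-vectors `eᵢ ∧ eⱼ` with `i < j` are an orthonormal basis. -/
def curvatureNormSq (x : M) : ℝ :=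
  let e := stdOrthonormalBasis ℝ (TangentSpace I x)
  ∑ i, ∑ j ∈ Finset.Ioi i, ∑ k, ∑ l ∈ Finset.Ioi k,
    (inner ℝ (curvature I (e i) (e j) (e k)) (e l)) ^ 2

/-- `‖cR‖²` at `x`. -/
def ricciNormSq (x : M) : ℝ :=
  let e := stdOrthonormalBasis ℝ (TangentSpace I x)
  ∑ i, ∑ j, (ricci I (e i) (e j)) ^ 2

/-- The second Hermann Weyl curvature invariant `h₄ = ‖R‖² - ‖cR‖² + ¼ ‖c²R‖²`. -/
def h4 (x : M) : ℝ :=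
  curvatureNormSq I x - ricciNormSq I x + (1 / 4 : ℝ) * (scalarCurvature I x) ^ 2

end Riemannian

section LieGroups

variable {E : Type*} [NormedAddCommGroup E] [NormedSpace ℝ E]
  {H : Type*} [TopologicalSpace H] (I : ModelWithCorners ℝ E H)
  (G : Type*) [TopologicalSpace G] [ChartedSpace H G] [Group G]

/-- The Riemannian metric of the Lie group `G` is bi-invariant: all left translations and all
right translations are isometries. -/
def IsBiinvariant [RiemannianBundle (fun x : G ↦ TangentSpace I x)] : Prop :=
  (∀ (a x : G) (v w : TangentSpace I x),
    inner ℝ (mfderiv I I (fun y ↦ a * y) x v) (mfderiv I I (fun y ↦ a * y) x w) = inner ℝ v w) ∧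
  (∀ (a x : G) (v w : TangentSpace I x),
    inner ℝ (mfderiv I I (fun y ↦ y * a) x v) (mfderiv I I (fun y ↦ y * a) x w) = inner ℝ v w)

theorem lieGroup_minSmoothness [LieGroup I ∞ G] : LieGroup I (minSmoothness ℝ 3) G := by
  have h : minSmoothness ℝ 3 ≤ (∞ : WithTop ℕ∞) := by
    rw [minSmoothness_of_isRCLikeNormedField]
    exact ENat.LEInfty.out
  exact LieGroup.of_le h

variable [FiniteDimensional ℝ E] [LieGroup I ∞ G]

/-- The rank of the Lie group `G`: the rank of its Lie algebra, i.e. the dimension of a Cartan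
subalgebra. For a compact Lie group this is the dimension of a maximal torus. -/
def lieRank : ℕ :=
  haveI : CompleteSpace E := FiniteDimensional.complete ℝ E
  haveI : LieGroup I (minSmoothness ℝ 3) G := lieGroup_minSmoothness I G
  LieAlgebra.rank ℝ (GroupLieAlgebra I G)

/-- The Lie group `G` has a simple Lie algebra. (A connected Lie group is called simple when this
holds.) -/
def HasSimpleLieAlgebra : Prop :=
  haveI : CompleteSpace E := FiniteDimensional.complete ℝ E
  haveI : LieGroup I (minSmoothness ℝ 3) G := lieGroup_minSmoothness I G
  LieAlgebra.IsSimple ℝ (GroupLieAlgebra I G)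

end LieGroups

section Submersions

variable {E : Type*} [NormedAddCommGroup E] [NormedSpace ℝ E]
  {H : Type*} [TopologicalSpace H] (I : ModelWithCorners ℝ E H)
  {E' : Type*} [NormedAddCommGroup E'] [NormedSpace ℝ E']
  {H' : Type*} [TopologicalSpace H'] (I' : ModelWithCorners ℝ E' H')
  {M : Type*} [TopologicalSpace M] [ChartedSpace H M]
  [RiemannianBundle (fun x : M ↦ TangentSpace I x)]
  {B : Type*} [TopologicalSpace B] [ChartedSpace H' B]
  [RiemannianBundle (fun x : B ↦ TangentSpace I' x)]

/-- `v` is orthogonal to the kernel of the differential of `f` at `x`. -/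
def IsHorizontal (f : M → B) {x : M} (v : TangentSpace I x) : Prop :=
  ∀ w : TangentSpace I x, mfderiv I I' f x w = 0 → inner ℝ v w = 0

/-- `f` is a Riemannian submersion: it is smooth, its differentials are surjective, and they are
isometric on horizontal vectors. -/
def IsRiemannianSubmersion (f : M → B) : Prop :=
  ContMDiff I I' ∞ f ∧
  (∀ x : M, Function.Surjective (mfderiv I I' f x)) ∧
  (∀ (x : M) (v w : TangentSpace I x), IsHorizontal I I' f v → IsHorizontal I I' f w →
    inner ℝ (mfderiv I I' f x v) (mfderiv I I' f x w) = inner ℝ v w)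

end Submersions

end SecondWeyl

end

noncomputable section

namespace SecondWeyl

section AlgebraicCurvature

open Finset

variable {V : Type*} [NormedAddCommGroup V] [InnerProductSpace ℝ V]

/-- The trace of a bilinear function does not depend on the orthonormal basis. -/
theorem sum_apply_self_eq_of_orthonormalBasis {ι ι' : Type*} [Fintype ι] [Fintype ι']
    (e : OrthonormalBasis ι ℝ V) (e' : OrthonormalBasis ι' ℝ V) (β : V → V → ℝ)
    (h₁ : ∀ w, IsLinearMap ℝ fun u ↦ β u w) (h₂ : ∀ u, IsLinearMap ℝ (β u)) :
    ∑ i, β (e i) (e i) = ∑ i, β (e' i) (e' i) := by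
  classical
  let B : V →ₗ[ℝ] V →ₗ[ℝ] ℝ := LinearMap.mk₂ ℝ β (fun u v w ↦ (h₁ w).map_add u v)
    (fun c u w ↦ (h₁ w).map_smul c u) (fun u v w ↦ (h₂ u).map_add v w)
    (fun c u w ↦ (h₂ u).map_smul c w)
  have hB : ∀ u w, β u w = B u w := fun _ _ ↦ rfl
  have key : ∀ i, B (e i) (e i) =
      ∑ j, ∑ k, (inner ℝ (e' j) (e i) * inner ℝ (e i) (e' k)) * B (e' j) (e' k) := by
    intro i
    conv_lhs => rw [← e'.sum_repr' (e i)]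
    simp only [map_sum, map_smul, LinearMap.sum_apply, LinearMap.smul_apply, smul_eq_mul,
      Finset.mul_sum]
    rw [Finset.sum_comm]
    refine Finset.sum_congr rfl fun j _ ↦ Finset.sum_congr rfl fun k _ ↦ ?_
    rw [real_inner_comm (e i) (e' k)]
    ring
  simp only [hB, key]
  rw [Finset.sum_comm]
  refine Finset.sum_congr rfl fun j _ ↦ ?_
  rw [Finset.sum_comm]
  simp only [← Finset.sum_mul, e.sum_inner_mul_inner]
  simp [e'.inner_eq_ite]

/-- `R` is an algebraic curvature tensor (the first Bianchi identity enters through the pair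
symmetry only). -/
structure IsCurvatureLike (R : V → V → V → V → ℝ) : Prop where
  isLinearMap : ∀ v w z, IsLinearMap ℝ fun u ↦ R u v w z
  swap_left : ∀ u v w z, R u v w z = -R v u w z
  swap_right : ∀ u v w z, R u v w z = -R u v z w
  pair_symm : ∀ u v w z, R u v w z = R w z u v

namespace IsCurvatureLike

variable {R : V → V → V → V → ℝ} (hR : IsCurvatureLike R)
include hR

theorem isLinearMap₂ (u w z : V) : IsLinearMap ℝ fun v ↦ R u v w z := by
  have h := hR.isLinearMap u w z
  constructor
  · intro a b
    rw [hR.swap_left, hR.swap_left u a, hR.swap_left u b, h.map_add]; ring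
  · intro c a
    rw [hR.swap_left, hR.swap_left u a, h.map_smul, smul_neg]

theorem isLinearMap₃ (u v z : V) : IsLinearMap ℝ fun w ↦ R u v w z := by
  simp only [hR.pair_symm u v]
  exact hR.isLinearMap z u v

theorem isLinearMap₄ (u v w : V) : IsLinearMap ℝ fun z ↦ R u v w z := by
  simp only [hR.pair_symm u v]
  exact hR.isLinearMap₂ w u v

theorem apply_self_left (u w z : V) : R u u w z = 0 := by
  have := hR.swap_left u u w z; linarith

theorem apply_self_right (u v w : V) : R u v w w = 0 := by
  have := hR.swap_right u v w w; linarith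

variable {ι ι' : Type*} [Fintype ι] [Fintype ι']

theorem ricci_eq (e : OrthonormalBasis ι ℝ V) (e' : OrthonormalBasis ι' ℝ V) (v w : V) :
    ∑ i, R (e i) v w (e i) = ∑ i, R (e' i) v w (e' i) :=
  sum_apply_self_eq_of_orthonormalBasis e e' (fun u z ↦ R u v w z)
    (fun z ↦ hR.isLinearMap v w z) (fun u ↦ hR.isLinearMap₄ u v w)

omit hR in
theorem sum_sq_eq_of_orthonormalBasis (e : OrthonormalBasis ι ℝ V) (e' : OrthonormalBasis ι' ℝ V)
    (φ : V → ℝ) (h : IsLinearMap ℝ φ) : ∑ i, φ (e i) ^ 2 = ∑ i, φ (e' i) ^ 2 := by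
  simp only [pow_two]
  refine sum_apply_self_eq_of_orthonormalBasis e e' (fun u z ↦ φ u * φ z) (fun z ↦ ?_) fun u ↦ ?_
  · exact ⟨fun a b ↦ by rw [h.map_add]; ring, fun c a ↦ by simp [h.map_smul, mul_assoc]⟩
  · exact ⟨fun a b ↦ by rw [h.map_add]; ring, fun c a ↦ by simp [h.map_smul, mul_left_comm]⟩

theorem sum_sq_eq (e : OrthonormalBasis ι ℝ V) (e' : OrthonormalBasis ι' ℝ V) :
    ∑ i, ∑ j, ∑ k, ∑ l, R (e i) (e j) (e k) (e l) ^ 2 =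
      ∑ i, ∑ j, ∑ k, ∑ l, R (e' i) (e' j) (e' k) (e' l) ^ 2 := by
  calc ∑ i, ∑ j, ∑ k, ∑ l, R (e i) (e j) (e k) (e l) ^ 2
      = ∑ i, ∑ j, ∑ k, ∑ l, R (e i) (e j) (e k) (e' l) ^ 2 := by
        refine sum_congr rfl fun i _ ↦ sum_congr rfl fun j _ ↦ sum_congr rfl fun k _ ↦ ?_
        exact sum_sq_eq_of_orthonormalBasis e e' _ (hR.isLinearMap₄ _ _ _)
    _ = ∑ i, ∑ j, ∑ l, ∑ k, R (e i) (e j) (e' k) (e' l) ^ 2 := by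
        refine sum_congr rfl fun i _ ↦ sum_congr rfl fun j _ ↦ ?_
        rw [sum_comm]
        exact sum_congr rfl fun l _ ↦
          sum_sq_eq_of_orthonormalBasis e e' (fun w ↦ R _ _ w _) (hR.isLinearMap₃ _ _ _)
    _ = ∑ i, ∑ l, ∑ k, ∑ j, R (e i) (e' j) (e' k) (e' l) ^ 2 := by
        refine sum_congr rfl fun i _ ↦ ?_
        rw [sum_comm]
        refine sum_congr rfl fun l _ ↦ ?_
        rw [sum_comm]
        exact sum_congr rfl fun k _ ↦
          sum_sq_eq_of_orthonormalBasis e e' (fun w ↦ R _ w _ _) (hR.isLinearMap₂ _ _ _)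
    _ = ∑ l, ∑ k, ∑ j, ∑ i, R (e' i) (e' j) (e' k) (e' l) ^ 2 := by
        rw [sum_comm]
        refine sum_congr rfl fun l _ ↦ ?_
        rw [sum_comm]
        refine sum_congr rfl fun k _ ↦ ?_
        rw [sum_comm]
        exact sum_congr rfl fun j _ ↦
          sum_sq_eq_of_orthonormalBasis e e' (fun w ↦ R w _ _ _) (hR.isLinearMap _ _ _)
    _ = _ := by
        refine sum_congr rfl fun l _ ↦ sum_congr rfl fun k _ ↦ sum_congr rfl fun j _ ↦
          sum_congr rfl fun i _ ↦ ?_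
        rw [hR.pair_symm, hR.swap_left, hR.swap_right, neg_neg]

end IsCurvatureLike

theorem two_mul_sum_sum_Ioi {n : ℕ} (a : Fin n → Fin n → ℝ) (hs : ∀ i j, a i j = a j i)
    (h0 : ∀ i, a i i = 0) : 2 * ∑ i, ∑ j ∈ Ioi i, a i j = ∑ i, ∑ j, a i j := by
  have h1 : ∀ i, ∑ j, a i j = ∑ j ∈ Ioi i, a i j + ∑ j ∈ Iio i, a i j := by
    intro i
    rw [← Finset.sum_filter_add_sum_filter_not univ (fun j ↦ i < j)]
    congr 1
    · exact sum_congr (by ext; simp) fun _ _ ↦ rfl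
    · rw [← Finset.sum_subset (s₁ := Iio i)]
      · intro j; simp only [mem_Iio, mem_filter, mem_univ, true_and, not_lt]; exact le_of_lt
      · intro j hj hj'
        simp only [mem_Iio, mem_filter, mem_univ, true_and, not_lt] at hj hj'
        rw [le_antisymm hj hj', h0]
  have h2 : ∑ i, ∑ j ∈ Iio i, a i j = ∑ i, ∑ j ∈ Ioi i, a i j := by
    rw [Finset.sum_comm' (t' := univ) (s' := fun j ↦ Ioi j) (by simp)]
    simp only [hs]
  simp only [h1, sum_add_distrib, h2]
  ring

/-- For a symmetric matrix `K` with vanishing diagonal, the quadratic expression of `h₄` is a sum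
over pairs of disjoint index pairs. -/
theorem sum_disjoint_pairs {ι : Type*} [Fintype ι] [DecidableEq ι] (K : ι → ι → ℝ)
    (hs : ∀ i j, K i j = K j i) (h0 : ∀ i, K i i = 0) :
    ∑ i, ∑ j, ∑ k, ∑ l, (if i ≠ k ∧ i ≠ l ∧ j ≠ k ∧ j ≠ l then K i j * K k l else 0) =
      (∑ i, ∑ j, K i j) ^ 2 - 4 * ∑ i, (∑ j, K i j) ^ 2 + 2 * ∑ i, ∑ j, K i j ^ 2 := by
  have key : ∀ i j k l, (if i ≠ k ∧ i ≠ l ∧ j ≠ k ∧ j ≠ l then K i j * K k l else 0) =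
      K i j * K k l - (if k = i then K i j * K k l else 0) - (if l = i then K i j * K k l else 0)
        - (if k = j then K i j * K k l else 0) - (if l = j then K i j * K k l else 0)
        + (if k = i then if l = j then K i j * K k l else 0 else 0)
        + (if k = j then if l = i then K i j * K k l else 0 else 0) := by
    intro i j k l
    by_cases hij : i = j
    · subst hij; simp [h0]
    by_cases hkl : k = l
    · subst hkl; simp [h0]
    by_cases h1 : k = i <;> by_cases h2 : l = i <;> by_cases h3 : k = j <;> by_cases h4 : l = j <;>
      grind
  have hr : ∀ j, ∑ i, K i j = ∑ i, K j i := fun j ↦ sum_congr rfl fun i _ ↦ hs i j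
  simp only [key, sum_add_distrib, sum_sub_distrib]
  have hc : ∀ (p : Prop) [Decidable p] (f : ι → ℝ),
      ∑ l, (if p then f l else 0) = if p then ∑ l, f l else 0 := by
    intro p _ f; split_ifs <;> simp
  simp only [hc, sum_ite_eq', mem_univ, if_true, ← mul_sum, ← sum_mul]
  have h1 : ∑ i, ∑ j, K i j * ∑ k, K i k = ∑ i, (∑ j, K i j) ^ 2 :=
    sum_congr rfl fun i _ ↦ by rw [← sum_mul, pow_two]
  have h2 : ∑ i, ∑ j, K i j * ∑ k, K j k = ∑ i, (∑ j, K i j) ^ 2 := by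
    rw [sum_comm, ← h1]
    exact sum_congr rfl fun i _ ↦ sum_congr rfl fun j _ ↦ by rw [hs]
  simp only [h2, ← pow_two, fun i j ↦ hs j i]
  ring

namespace IsCurvatureLike

/-- The second Hermann Weyl invariant of an algebraic curvature tensor, computed in an orthonormal
basis. -/
def weylInvariant (R : V → V → V → V → ℝ) {n : ℕ} (e : OrthonormalBasis (Fin n) ℝ V) : ℝ :=
  ∑ i, ∑ j ∈ Ioi i, ∑ k, ∑ l ∈ Ioi k, R (e i) (e j) (e k) (e l) ^ 2
    - ∑ i, ∑ j, (∑ m, R (e m) (e i) (e j) (e m)) ^ 2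
    + (1 / 4 : ℝ) * (∑ i, ∑ m, R (e m) (e i) (e i) (e m)) ^ 2

variable {R : V → V → V → V → ℝ} (hR : IsCurvatureLike R)
include hR

theorem four_mul_sum_Ioi {n : ℕ} (e : OrthonormalBasis (Fin n) ℝ V) :
    4 * ∑ i, ∑ j ∈ Ioi i, ∑ k, ∑ l ∈ Ioi k, R (e i) (e j) (e k) (e l) ^ 2 =
      ∑ i, ∑ j, ∑ k, ∑ l, R (e i) (e j) (e k) (e l) ^ 2 := by
  have h1 : ∀ i j, 2 * ∑ k, ∑ l ∈ Ioi k, R (e i) (e j) (e k) (e l) ^ 2 =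
      ∑ k, ∑ l, R (e i) (e j) (e k) (e l) ^ 2 := fun i j ↦
    two_mul_sum_sum_Ioi (fun k l ↦ R (e i) (e j) (e k) (e l) ^ 2)
      (fun k l ↦ by simp only [hR.swap_right _ _ (e k), neg_sq])
      (fun k ↦ by simp [hR.apply_self_right])
  have h2 := two_mul_sum_sum_Ioi (fun i j ↦ ∑ k, ∑ l ∈ Ioi k, R (e i) (e j) (e k) (e l) ^ 2)
    (fun i j ↦ by simp only [hR.swap_left (e i), neg_sq])
    (fun i ↦ by simp [hR.apply_self_left])
  simp only [← h1, ← mul_sum] at h2 ⊢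
  linarith

theorem ricci_symm {ι : Type*} [Fintype ι] (e : OrthonormalBasis ι ℝ V) (v w : V) :
    ∑ m, R (e m) v w (e m) = ∑ m, R (e m) w v (e m) :=
  sum_congr rfl fun m _ ↦ by
    rw [hR.pair_symm, hR.swap_left, hR.swap_right, neg_neg]

theorem isLinearMap_ricci {ι : Type*} [Fintype ι] (e : OrthonormalBasis ι ℝ V) (w : V) :
    IsLinearMap ℝ fun v ↦ ∑ m, R (e m) v w (e m) :=
  ⟨fun a b ↦ by simp only [(hR.isLinearMap₂ _ _ _).map_add, sum_add_distrib],
    fun c a ↦ by simp only [(hR.isLinearMap₂ _ _ _).map_smul, smul_sum]⟩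

theorem weylInvariant_eq {n m : ℕ} (e : OrthonormalBasis (Fin n) ℝ V)
    (e' : OrthonormalBasis (Fin m) ℝ V) :
    weylInvariant R e = weylInvariant R e' := by
  have h1 := hR.sum_sq_eq e e'
  rw [← hR.four_mul_sum_Ioi, ← hR.four_mul_sum_Ioi] at h1
  have hlin' : ∀ v, IsLinearMap ℝ fun w ↦ ∑ m, R (e' m) v w (e' m) := fun v ↦ by
    simp only [hR.ricci_symm e' v]; exact hR.isLinearMap_ricci e' v
  have h2 : ∑ i, ∑ j, (∑ m, R (e m) (e i) (e j) (e m)) ^ 2 =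
      ∑ i, ∑ j, (∑ m, R (e' m) (e' i) (e' j) (e' m)) ^ 2 := by
    simp only [hR.ricci_eq e e']
    have h3 : ∀ i, ∑ j, (∑ m, R (e' m) (e i) (e j) (e' m)) ^ 2 =
        ∑ j, (∑ m, R (e' m) (e i) (e' j) (e' m)) ^ 2 := fun i ↦
      sum_sq_eq_of_orthonormalBasis e e' _ (hlin' (e i))
    simp only [h3]
    rw [sum_comm]
    refine Eq.trans ?_ sum_comm
    exact sum_congr rfl fun j _ ↦
      sum_sq_eq_of_orthonormalBasis e e' _ (hR.isLinearMap_ricci e' (e' j))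
  have h3 : ∑ i, ∑ m, R (e m) (e i) (e i) (e m) = ∑ i, ∑ m, R (e' m) (e' i) (e' i) (e' m) := by
    simp only [hR.ricci_eq e e']
    exact sum_apply_self_eq_of_orthonormalBasis e e' (fun v w ↦ ∑ m, R (e' m) v w (e' m))
      (hR.isLinearMap_ricci e') hlin'
  unfold weylInvariant
  rw [h2, h3]
  linarith

/-- An orthonormal basis in which the Ricci tensor is diagonal. -/
theorem exists_orthonormalBasis_ricci [FiniteDimensional ℝ V] :
    ∃ e : OrthonormalBasis (Fin (Module.finrank ℝ V)) ℝ V,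
      ∀ i j, i ≠ j → ∑ m, R (e m) (e i) (e j) (e m) = 0 := by
  let e := stdOrthonormalBasis ℝ V
  let ρ : V → V → ℝ := fun v w ↦ ∑ m, R (e m) v w (e m)
  let A : V →ₗ[ℝ] V :=
    { toFun := fun v ↦ ∑ j, ρ v (e j) • e j
      map_add' := fun v w ↦ by
        simp only [ρ, (hR.isLinearMap_ricci e _).map_add, add_smul, sum_add_distrib]
      map_smul' := fun c v ↦ by
        simp only [ρ, (hR.isLinearMap_ricci e _).map_smul, RingHom.id_apply, ← smul_sum,
          smul_eq_mul, mul_smul] }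
  have hA : ∀ v w, inner ℝ (A v) w = ρ v w := by
    intro v w
    have hw : ρ w v = ∑ j, inner ℝ (e j) w * ρ (e j) v := by
      let L := (hR.isLinearMap_ricci e v).mk' _
      have : L w = ∑ j, inner ℝ (e j) w * L (e j) := by
        conv_lhs => rw [← e.sum_repr' w]
        simp [map_sum]
      exact this
    rw [show ρ v w = ρ w v from hR.ricci_symm e v w, hw]
    simp only [A, LinearMap.coe_mk, AddHom.coe_mk, sum_inner, real_inner_smul_left]
    exact sum_congr rfl fun j _ ↦ by
      rw [mul_comm, show ρ v (e j) = ρ (e j) v from hR.ricci_symm e _ _]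
  have hsymm : A.IsSymmetric := fun v w ↦ by
    rw [hA, real_inner_comm, hA]; exact hR.ricci_symm e v w
  refine ⟨hsymm.eigenvectorBasis rfl, fun i j hij ↦ ?_⟩
  rw [hR.ricci_eq _ e]
  change ρ _ _ = 0
  rw [← hA, hsymm.apply_eigenvectorBasis, RCLike.ofReal_real_eq_id, id, real_inner_smul_left,
    OrthonormalBasis.inner_eq_zero _ hij, mul_zero]

/-- If the sectional curvatures are nonnegative, then `h₄` is positive unless all sectional
curvatures of a family of orthonormal vectors of codimension `2` vanish. -/
theorem weylInvariant_pos_or [FiniteDimensional ℝ V] (hpos : ∀ u v, 0 ≤ R u v v u)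
    {n : ℕ} (e₀ : OrthonormalBasis (Fin n) ℝ V) :
    0 < weylInvariant R e₀ ∨ ∃ (e : OrthonormalBasis (Fin (Module.finrank ℝ V)) ℝ V)
      (S : Finset (Fin (Module.finrank ℝ V))), Module.finrank ℝ V - 2 ≤ S.card ∧
      ∀ i ∈ S, ∀ j ∈ S, R (e i) (e j) (e j) (e i) = 0 := by
  obtain ⟨e, he⟩ := hR.exists_orthonormalBasis_ricci
  rw [or_iff_not_imp_left, not_lt, hR.weylInvariant_eq e₀ e]
  intro hle
  refine ⟨e, ?_⟩
  let K : Fin (Module.finrank ℝ V) → Fin (Module.finrank ℝ V) → ℝ :=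
    fun i j ↦ R (e i) (e j) (e j) (e i)
  have hs : ∀ i j, K i j = K j i := fun i j ↦ by
    simp only [K]; rw [hR.pair_symm]
  have h0 : ∀ i, K i i = 0 := fun i ↦ hR.apply_self_left _ _ _
  have hric : ∑ i, ∑ j, (∑ m, R (e m) (e i) (e j) (e m)) ^ 2 = ∑ i, (∑ j, K i j) ^ 2 := by
    refine sum_congr rfl fun i _ ↦ ?_
    rw [sum_eq_single i]
    · congr 1
      exact sum_congr rfl fun m _ ↦ hs m i
    · intro j _ hj; rw [he i j hj.symm]; simp
    · simp
  have hscal : ∑ i, ∑ m, R (e m) (e i) (e i) (e m) = ∑ i, ∑ j, K i j :=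
    sum_congr rfl fun i _ ↦ sum_congr rfl fun m _ ↦ hs m i
  have hnorm : 2 * ∑ i, ∑ j, K i j ^ 2 ≤ ∑ i, ∑ j, ∑ k, ∑ l, R (e i) (e j) (e k) (e l) ^ 2 := by
    rw [mul_sum]
    refine sum_le_sum fun i _ ↦ ?_
    rw [mul_sum]
    refine sum_le_sum fun j _ ↦ ?_
    rcases eq_or_ne i j with rfl | hij
    · rw [h0]
      have : 0 ≤ ∑ k, ∑ l, R (e i) (e i) (e k) (e l) ^ 2 := by positivity
      linarith
    · rw [← sum_product']
      calc 2 * K i j ^ 2 = ∑ p ∈ {(i, j), (j, i)}, R (e i) (e j) (e p.1) (e p.2) ^ 2 := by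
            rw [sum_pair (by simp [hij])]
            simp only [K, hR.swap_right _ _ (e i), neg_sq]
            ring
        _ ≤ _ := sum_le_sum_of_subset_of_nonneg (by simp) fun _ _ _ ↦ sq_nonneg _
  have hzero : ∀ i j k l, i ≠ k → i ≠ l → j ≠ k → j ≠ l → K i j * K k l = 0 := by
    have hnn : ∀ i j k l, 0 ≤ (if i ≠ k ∧ i ≠ l ∧ j ≠ k ∧ j ≠ l then K i j * K k l else 0) := by
      intro i j k l
      split_ifs
      · exact mul_nonneg (hpos _ _) (hpos _ _)
      · rfl
    have hsum := sum_disjoint_pairs K hs h0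
    have h4 := hR.four_mul_sum_Ioi e
    unfold weylInvariant at hle
    rw [hric, hscal] at hle
    have hle' : ∑ i, ∑ j, ∑ k, ∑ l,
        (if i ≠ k ∧ i ≠ l ∧ j ≠ k ∧ j ≠ l then K i j * K k l else 0) ≤ 0 := by
      rw [hsum]; linarith
    intro i j k l h1 h2 h3 h4
    refine le_antisymm ?_ (mul_nonneg (hpos _ _) (hpos _ _))
    refine le_trans ?_ hle'
    calc K i j * K k l = (if i ≠ k ∧ i ≠ l ∧ j ≠ k ∧ j ≠ l then K i j * K k l else 0) := by
          rw [if_pos ⟨h1, h2, h3, h4⟩]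
      _ ≤ ∑ l, (if i ≠ k ∧ i ≠ l ∧ j ≠ k ∧ j ≠ l then K i j * K k l else 0) :=
          single_le_sum (f := fun l ↦ if i ≠ k ∧ i ≠ l ∧ j ≠ k ∧ j ≠ l then K i j * K k l else 0)
            (fun l _ ↦ hnn i j k l) (mem_univ l)
      _ ≤ ∑ k, ∑ l, (if i ≠ k ∧ i ≠ l ∧ j ≠ k ∧ j ≠ l then K i j * K k l else 0) :=
          single_le_sum (f := fun k ↦ ∑ l, if i ≠ k ∧ i ≠ l ∧ j ≠ k ∧ j ≠ l then _ else 0)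
            (fun k _ ↦ sum_nonneg fun l _ ↦ hnn i j k l) (mem_univ k)
      _ ≤ ∑ j, ∑ k, ∑ l, (if i ≠ k ∧ i ≠ l ∧ j ≠ k ∧ j ≠ l then K i j * K k l else 0) :=
          single_le_sum (f := fun j ↦ ∑ k, ∑ l, if i ≠ k ∧ i ≠ l ∧ j ≠ k ∧ j ≠ l then _ else 0)
            (fun j _ ↦ sum_nonneg fun k _ ↦ sum_nonneg fun l _ ↦ hnn i j k l) (mem_univ j)
      _ ≤ _ :=
          single_le_sum
            (f := fun i ↦ ∑ j, ∑ k, ∑ l, if i ≠ k ∧ i ≠ l ∧ j ≠ k ∧ j ≠ l then _ else 0)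
            (fun i _ ↦ sum_nonneg fun j _ ↦ sum_nonneg fun k _ ↦ sum_nonneg fun l _ ↦ hnn i j k l)
            (mem_univ i)
  by_cases hK : ∀ i j, K i j = 0
  · exact ⟨univ, by simp, fun i _ j _ ↦ hK i j⟩
  · push Not at hK
    obtain ⟨a, b, hab⟩ := hK
    refine ⟨({a, b} : Finset _)ᶜ, ?_, fun i hi j hj ↦ ?_⟩
    · rw [card_compl, Fintype.card_fin]
      have := card_le_two (a := a) (b := b)
      omega
    · simp only [mem_compl, mem_insert, mem_singleton, not_or] at hi hj
      exact (mul_eq_zero.1 (hzero i j a b hi.1 hi.2 hj.1 hj.2)).resolve_right hab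

end IsCurvatureLike

end AlgebraicCurvature

section InvariantBracket

open Module

variable {V : Type*} [NormedAddCommGroup V] [InnerProductSpace ℝ V]

/-- `br` is a Lie bracket for which the inner product is invariant. -/
structure IsInvariantBracket (br : V →ₗ[ℝ] V →ₗ[ℝ] V) : Prop where
  skew : ∀ x y, br x y = -br y x
  leibniz : ∀ x y z, br x (br y z) = br (br x y) z + br y (br x z)
  invariant : ∀ x y z, inner ℝ (br x y) z = -inner ℝ y (br x z)

namespace IsInvariantBracket

variable {br : V →ₗ[ℝ] V →ₗ[ℝ] V} (hbr : IsInvariantBracket br)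
include hbr

theorem apply_self (x : V) : br x x = 0 := by
  have h := hbr.skew x x
  have h2 : (2 : ℝ) • br x x = 0 := by rw [two_smul]; nth_rewrite 1 [h]; exact neg_add_cancel _
  exact (smul_eq_zero.1 h2).resolve_left two_ne_zero

theorem eq_zero_of_apply_apply_eq_zero {x z : V} (h : br x (br x z) = 0) : br x z = 0 := by
  rw [← inner_self_eq_zero (𝕜 := ℝ), hbr.invariant, h, inner_zero_right, neg_zero]

theorem commute {x y : V} (h : br x y = 0) (z : V) : br x (br y z) = br y (br x z) := by
  rw [hbr.leibniz, h, map_zero, LinearMap.zero_apply, zero_add]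

theorem inner_eq_zero_of_mem_ker {x y z : V} (h : br x z = 0) : inner ℝ (br x y) z = 0 := by
  rw [hbr.invariant, h, inner_zero_right, neg_zero]

variable [FiniteDimensional ℝ V]

/-- Every vector is the sum of an element of the kernel and an element of the range of `br x`. -/
theorem exists_decomposition (x w : V) : ∃ n m, br x n = 0 ∧ w = n + br x m := by
  obtain ⟨p, hp, q, hq, rfl⟩ :=
    Submodule.exists_add_mem_mem_orthogonal (K := LinearMap.range (br x)) w
  obtain ⟨m, rfl⟩ := hp
  refine ⟨q, m, ?_, add_comm _ _⟩
  have h : inner ℝ (br x (br x q)) q = 0 := by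
    exact (Submodule.mem_orthogonal _ _).1 hq _ ⟨_, rfl⟩
  rw [hbr.invariant, neg_eq_zero, inner_self_eq_zero] at h
  exact h

/-- If `y` has a centralizer of minimal dimension among the elements of the subspace `a`, then the
centralizer of `y` is contained in that of every element of `a` commuting with `y`. -/
theorem apply_eq_zero_of_minimal (a : Submodule ℝ V) {y : V} (hy : y ∈ a)
    (hmin : ∀ x ∈ a, finrank ℝ (LinearMap.ker (br y)) ≤ finrank ℝ (LinearMap.ker (br x)))
    {x : V} (hx : x ∈ a) (hyx : br y x = 0) {w : V} (hw : br y w = 0) : br x w = 0 := by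
  by_contra hxw
  let M := LinearMap.range (br y)
  have hM : ∀ (z : V), br y z = 0 → z ∈ M → z = 0 := by
    rintro _ hz ⟨m, rfl⟩
    exact hbr.eq_zero_of_apply_apply_eq_zero hz
  have hYM : ∀ m ∈ M, br y m ∈ M := fun m _ ↦ ⟨m, rfl⟩
  have hXM : ∀ m ∈ M, br x m ∈ M := by
    rintro _ ⟨m, rfl⟩
    exact ⟨br x m, hbr.commute hyx m⟩
  let Y : M →ₗ[ℝ] M := (br y).restrict hYM
  let X : M →ₗ[ℝ] M := (br x).restrict hXM
  have hY : Function.Injective Y := by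
    rw [← LinearMap.ker_eq_bot, LinearMap.ker_eq_bot']
    intro m hm
    exact Subtype.ext (hM m (congrArg Subtype.val hm) m.2)
  let Ye := LinearEquiv.ofInjectiveEndo Y hY
  obtain ⟨s, hs⟩ := ((End.finite_hasEigenvalue (Ye.symm.toLinearMap ∘ₗ X)).union
    (Set.finite_singleton (0 : ℝ))).infinite_compl.nonempty
  simp only [Set.mem_compl_iff, Set.mem_union, Set.mem_singleton_iff, not_or] at hs
  obtain ⟨hs, hs0⟩ := hs
  have hsM : ∀ m ∈ M, s • br y m = br x m → m = 0 := by
    intro m hm h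
    by_contra hm0
    refine hs (End.hasEigenvalue_of_hasEigenvector (x := ⟨m, hm⟩) ⟨?_, fun h ↦ hm0 ?_⟩)
    · rw [End.mem_eigenspace_iff]
      simp only [LinearMap.comp_apply, LinearEquiv.coe_coe]
      rw [LinearEquiv.symm_apply_eq, map_smul]
      exact Subtype.ext h.symm
    · simpa using congrArg Subtype.val h
  have hle : LinearMap.ker (br (s • y - x)) < LinearMap.ker (br y) := by
    refine lt_of_le_of_ne ?_ ?_
    · intro z hz
      rw [LinearMap.mem_ker] at hz ⊢
      obtain ⟨n, m, hn, rfl⟩ := hbr.exists_decomposition y z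
      simp only [map_sub, map_smul, LinearMap.sub_apply, LinearMap.smul_apply, map_add, hn,
        smul_zero] at hz
      have h1 : s • br y (br y m) - br x (br y m) = br x n := by
        rw [← sub_eq_zero, ← hz]
        abel
      have h2 : br x n = 0 := by
        refine hM _ ?_ ?_
        · rw [hbr.commute hyx, hn, map_zero]
        · rw [← h1]
          exact M.sub_mem (M.smul_mem _ ⟨_, rfl⟩) (hXM _ ⟨_, rfl⟩)
      rw [h2, sub_eq_zero] at h1
      rw [map_add, hn, hsM _ ⟨m, rfl⟩ h1, map_zero, add_zero]
    · intro h
      have : w ∈ LinearMap.ker (br (s • y - x)) := by rw [h]; exact hw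
      simp only [LinearMap.mem_ker, map_sub, map_smul, LinearMap.sub_apply, LinearMap.smul_apply,
        hw, smul_zero, zero_sub, neg_eq_zero] at this
      exact hxw this
  exact absurd (Submodule.finrank_lt_finrank_of_lt hle)
    (not_lt.2 (hmin _ (a.sub_mem (a.smul_mem _ hy) hx)))

omit hbr [FiniteDimensional ℝ V] in
theorem exists_minimal (a : Submodule ℝ V) (br : V →ₗ[ℝ] V →ₗ[ℝ] V) : ∃ y ∈ a, ∀ x ∈ a,
    finrank ℝ (LinearMap.ker (br y)) ≤ finrank ℝ (LinearMap.ker (br x)) := by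
  obtain ⟨y, hy, h⟩ := exists_minimalFor_of_wellFoundedLT (fun x ↦ x ∈ a)
    (fun x ↦ finrank ℝ (LinearMap.ker (br x))) ⟨0, a.zero_mem⟩
  exact ⟨y, hy, fun x hx ↦ (le_total _ _).elim id (h hx)⟩

/-- The one-parameter group of automorphisms generated by an inner derivation. -/
theorem exists_exp (z : V) : ∃ φ : ℝ → V →L[ℝ] V, φ 0 = 1 ∧
    (∀ v t, HasDerivAt (fun t ↦ φ t v) (br z (φ t v)) t) ∧
    (∀ t v w, inner ℝ (φ t v) (φ t w) = inner ℝ v w) ∧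
    ∀ t v w, φ t (br v w) = br (φ t v) (φ t w) := by
  let D : V →L[ℝ] V := LinearMap.toContinuousLinearMap (br z)
  have hD : ∀ v, D v = br z v := fun _ ↦ rfl
  let φ : ℝ → V →L[ℝ] V := fun t ↦ NormedSpace.exp (t • D)
  have h0 : φ 0 = 1 := by simp [φ]
  have hφ : ∀ v t, HasDerivAt (fun t ↦ φ t v) (br z (φ t v)) t := by
    intro v t
    have := hasDerivAt_exp_smul_const' (𝕂 := ℝ) D t
    have h2 := ((ContinuousLinearMap.apply ℝ V v).hasFDerivAt.comp_hasDerivAt t this)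
    exact h2
  have hconst : ∀ f : ℝ → ℝ, (∀ t, HasDerivAt f 0 t) → ∀ t, f t = f 0 := fun f hf t ↦
    is_const_of_deriv_eq_zero (fun t ↦ (hf t).differentiableAt) (fun t ↦ (hf t).deriv) t 0
  refine ⟨φ, h0, hφ, ?_, ?_⟩
  · intro t v w
    rw [hconst (fun t ↦ inner ℝ (φ t v) (φ t w)) (fun t ↦ ?_) t, h0]
    · rfl
    · refine ((hφ v t).inner ℝ (hφ w t)).congr_deriv ?_
      rw [hbr.invariant]; ring
  · intro t v w
    let Bc : V →L[ℝ] V →L[ℝ] V :=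
      LinearMap.toContinuousLinearMap (LinearMap.toContinuousLinearMap.toLinearMap ∘ₗ br)
    have hBc : ∀ a b, Bc a b = br a b := fun _ _ ↦ rfl
    let h : ℝ → V := fun t ↦ br (φ t v) (φ t w) - φ t (br v w)
    have hh : ∀ t, HasDerivAt h (br z (h t)) t := by
      intro t
      have h1 : HasDerivAt (fun t ↦ br (φ t v) (φ t w)) _ t :=
        (Bc.hasFDerivAt.comp_hasDerivAt t (hφ v t)).clm_apply (hφ w t)
      refine (h1.sub (hφ (br v w) t)).congr_deriv ?_
      simp only [h, map_sub, hbr.leibniz z (φ t v), Function.comp_apply, hBc]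
    have h2 : inner ℝ (h t) (h t) = (0 : ℝ) := by
      rw [hconst (fun t ↦ inner ℝ (h t) (h t)) (fun t ↦ ?_) t]
      · simp [h, h0]
      · refine ((hh t).inner ℝ (hh t)).congr_deriv ?_
        rw [hbr.invariant]; ring
    rw [inner_self_eq_zero, sub_eq_zero] at h2
    exact h2.symm

/-- Any element can be moved into the centralizer of any other element by an isometric
automorphism. -/
theorem exists_automorphism (x y : V) : ∃ φ : V →L[ℝ] V,
    (∀ v w, inner ℝ (φ v) (φ w) = inner ℝ v w) ∧ (∀ v w, φ (br v w) = br (φ v) (φ w)) ∧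
    br (φ x) y = 0 := by
  let S : Set (V →L[ℝ] V) := {φ | (∀ v w, inner ℝ (φ v) (φ w) = inner ℝ v w) ∧
    ∀ v w, φ (br v w) = br (φ v) (φ w)}
  have hev : ∀ v, Continuous fun φ : V →L[ℝ] V ↦ φ v := fun v ↦
    (ContinuousLinearMap.apply ℝ V v).continuous
  let Bc : V →L[ℝ] V →L[ℝ] V :=
    LinearMap.toContinuousLinearMap (LinearMap.toContinuousLinearMap.toLinearMap ∘ₗ br)
  have hcl : IsClosed S := by
    simp only [S, Set.ofPred_and, Set.ofPred_forall]
    refine (isClosed_iInter fun v ↦ isClosed_iInter fun w ↦ ?_).inter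
      (isClosed_iInter fun v ↦ isClosed_iInter fun w ↦ ?_)
    · exact isClosed_eq ((hev v).inner (hev w)) continuous_const
    · exact isClosed_eq (hev _) ((Bc.continuous.comp (hev v)).clm_apply (hev w))
  have hbd : S ⊆ Metric.closedBall 0 1 := by
    rintro φ ⟨hφ, -⟩
    rw [mem_closedBall_zero_iff]
    refine φ.opNorm_le_bound zero_le_one fun v ↦ ?_
    rw [one_mul, ← sq_le_sq₀ (norm_nonneg _) (norm_nonneg _), ← real_inner_self_eq_norm_sq,
      ← real_inner_self_eq_norm_sq, hφ]
  have hS : IsCompact S := (isCompact_closedBall _ _).of_isClosed_subset hcl hbd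
  obtain ⟨φ, ⟨h1, h2⟩, hmax⟩ := hS.exists_isMaxOn ⟨1, fun _ _ ↦ rfl, fun _ _ ↦ rfl⟩
    (f := fun φ : V →L[ℝ] V ↦ inner ℝ (φ x) y) ((hev x).inner continuous_const).continuousOn
  refine ⟨φ, h1, h2, ?_⟩
  refine ext_inner_left ℝ fun z ↦ ?_
  obtain ⟨ψ, h0, hd, hi, ha⟩ := hbr.exists_exp z
  have hloc : IsLocalMax (fun t ↦ inner ℝ (ψ t (φ x)) y) 0 := by
    refine Filter.Eventually.of_forall fun t ↦ ?_
    have hmem : ψ t ∘L φ ∈ S := ⟨fun v w ↦ by simp [hi, h1], fun v w ↦ by simp [ha, h2]⟩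
    have := hmax hmem
    simpa [h0] using this
  have hder := hloc.hasDerivAt_eq_zero
    (((hd (φ x) 0).inner ℝ (hasDerivAt_const (0 : ℝ) y)))
  rw [h0, inner_zero_right, zero_add, one_apply_eq_self, hbr.skew, inner_neg_left,
    hbr.invariant, neg_neg] at hder
  rw [hder, inner_zero_right]

/-- The dimension of a commutative subspace is at most the dimension of any centralizer. -/
theorem finrank_le_finrank_ker (a : Submodule ℝ V) (ha : ∀ x ∈ a, ∀ y ∈ a, br x y = 0) (x : V) :
    finrank ℝ a ≤ finrank ℝ (LinearMap.ker (br x)) := by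
  obtain ⟨y, hy, hmin⟩ := exists_minimal a br
  obtain ⟨φ, h1, h2, h3⟩ := hbr.exists_automorphism x y
  have hinj : Function.Injective φ := by
    rw [injective_iff_map_eq_zero]
    intro v hv
    rw [← inner_self_eq_zero (𝕜 := ℝ), ← h1, hv, inner_zero_left]
  have hsurj : Function.Surjective φ :=
    LinearMap.injective_iff_surjective (f := φ.toLinearMap).1 hinj
  have hle : a ≤ (LinearMap.ker (br x)).map φ.toLinearMap := by
    intro w hw
    obtain ⟨w, rfl⟩ := hsurj w
    refine ⟨w, ?_, rfl⟩
    have h4 : br (φ w) (φ x) = 0 :=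
      hbr.apply_eq_zero_of_minimal a hy hmin hw (ha _ hy _ hw) (by rw [hbr.skew, h3, neg_zero])
    rw [SetLike.mem_coe, LinearMap.mem_ker]
    apply hinj
    rw [h2, hbr.skew, h4, neg_zero, map_zero]
  exact (Submodule.finrank_mono hle).trans (Submodule.finrank_map_le _ _)

/-- A bracket with trivial center has a centralizer of dimension less than half of the dimension
of the whole space. -/
theorem exists_two_mul_finrank_ker_lt (hc : ∀ x, (∀ y, br x y = 0) → x = 0)
    (hV : 0 < finrank ℝ V) : ∃ x, 2 * finrank ℝ (LinearMap.ker (br x)) < finrank ℝ V := by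
  obtain ⟨x, -, hmin⟩ := exists_minimal ⊤ br
  refine ⟨x, ?_⟩
  set T := LinearMap.ker (br x) with hT
  have hcomm : ∀ s ∈ T, ∀ t ∈ T, br s t = 0 := fun s hs t ht ↦
    hbr.apply_eq_zero_of_minimal ⊤ trivial hmin trivial hs ht
  obtain ⟨v, -, hv⟩ := exists_minimalFor_of_wellFoundedLT (fun _ ↦ True)
    (fun v ↦ finrank ℝ (T ⊓ LinearMap.ker (br.flip v) : Submodule ℝ V)) ⟨0, trivial⟩
  have hsep : ∀ s ∈ T, br s v = 0 → s = 0 := by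
    intro s hs hsv
    refine hc s fun w ↦ ?_
    by_contra hw
    obtain ⟨n, m, hn, rfl⟩ := hbr.exists_decomposition s w
    rw [map_add, hn, zero_add] at hw
    have hlt : T ⊓ LinearMap.ker (br.flip (v + br s m)) < T ⊓ LinearMap.ker (br.flip v) := by
      refine lt_of_le_of_ne ?_ ?_
      · rintro t ⟨ht, ht'⟩
        refine ⟨ht, ?_⟩
        simp only [SetLike.mem_coe, LinearMap.mem_ker, LinearMap.flip_apply,
          (br _).map_add] at ht' ⊢
        have hst := hcomm s hs t ht
        rw [← hbr.commute hst] at ht'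
        have h1 : br s (br t v) = 0 := by rw [hbr.commute hst, hsv, map_zero]
        have h2 := hbr.inner_eq_zero_of_mem_ker h1 (y := br t m)
        rw [add_eq_zero_iff_eq_neg] at ht'
        rw [← inner_self_eq_zero (𝕜 := ℝ)]
        nth_rewrite 1 [ht']
        rw [inner_neg_left, h2, neg_zero]
      · intro h
        have : s ∈ T ⊓ LinearMap.ker (br.flip (v + br s m)) := by
          rw [h]; exact ⟨hs, hsv⟩
        have h3 := this.2
        simp only [SetLike.mem_coe, LinearMap.mem_ker, LinearMap.flip_apply, (br _).map_add, hsv,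
          zero_add] at h3
        exact hw h3
    have h4 := Submodule.finrank_lt_finrank_of_lt hlt
    exact absurd (hv trivial h4.le) (not_le.2 h4)
  obtain ⟨v₀, hv₀, v₁, hv₁, rfl⟩ := Submodule.exists_add_mem_mem_orthogonal (K := T) v
  have hsep' : ∀ s ∈ T, br s v₁ = 0 → s = 0 := fun s hs h ↦
    hsep s hs (by rw [map_add, hcomm s hs _ hv₀, h, zero_add])
  have hsum := Submodule.finrank_add_finrank_orthogonal T
  rcases Nat.eq_zero_or_pos (finrank ℝ T) with h0 | h0
  · omega
  have hv1 : v₁ ≠ 0 := by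
    rintro rfl
    obtain ⟨s, hs⟩ := finrank_pos_iff_exists_ne_zero.1 h0
    exact hs (Subtype.ext (hsep' s s.2 (map_zero _)))
  let W := LinearMap.range ((br.flip v₁).domRestrict T)
  have hW : finrank ℝ W = finrank ℝ T := by
    refine LinearMap.finrank_range_of_inj ?_
    rw [← LinearMap.ker_eq_bot, LinearMap.ker_eq_bot']
    exact fun s hs ↦ Subtype.ext (hsep' s s.2 hs)
  have hWle : W < Tᗮ := by
    refine lt_of_le_of_ne ?_ ?_
    · rintro _ ⟨⟨s, hs⟩, rfl⟩
      rw [Submodule.mem_orthogonal']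
      intro t ht
      exact hbr.inner_eq_zero_of_mem_ker (hcomm s hs t ht)
    · intro h
      have : v₁ ∈ W := by rw [h]; exact hv₁
      obtain ⟨⟨s, hs⟩, h⟩ := this
      apply hv1
      rw [← inner_self_eq_zero (𝕜 := ℝ)]
      nth_rewrite 1 [← h]
      have := hbr.invariant s v₁ v₁
      rw [real_inner_comm v₁] at this
      rw [LinearMap.domRestrict_apply, LinearMap.flip_apply]
      have h5 := real_inner_comm v₁ (br s v₁)
      linarith
  have := Submodule.finrank_lt_finrank_of_lt hWle
  omega

end IsInvariantBracket

end InvariantBracket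

section Rank

open Module

variable {L : Type*} [LieRing L] [LieAlgebra ℝ L] [FiniteDimensional ℝ L]

omit [FiniteDimensional ℝ L] in
theorem finrank_engel_eq (h : ∀ x z : L, ⁅x, ⁅x, z⁆⁆ = 0 → ⁅x, z⁆ = 0) (x : L) :
    finrank ℝ (LieSubalgebra.engel ℝ x) = finrank ℝ (LinearMap.ker (LieAlgebra.ad ℝ L x)) := by
  have : (LieSubalgebra.engel ℝ x).toSubmodule = LinearMap.ker (LieAlgebra.ad ℝ L x) := by
    ext z
    rw [LieSubalgebra.mem_toSubmodule, LieSubalgebra.mem_engel_iff, LinearMap.mem_ker]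
    refine ⟨?_, fun hz ↦ ⟨1, by simpa using hz⟩⟩
    rintro ⟨n, hn⟩
    induction n with
    | zero => rw [show z = 0 by simpa using hn, map_zero]
    | succ n ih =>
      rcases n with - | n
      · simpa using hn
      · apply ih
        rw [pow_succ', pow_succ', Module.End.mul_apply, Module.End.mul_apply] at hn
        rw [pow_succ', Module.End.mul_apply]
        exact h x _ hn
  exact congrArg (fun S : Submodule ℝ L ↦ finrank ℝ S) this

theorem rank_le_finrank_ker_ad (h : ∀ x z : L, ⁅x, ⁅x, z⁆⁆ = 0 → ⁅x, z⁆ = 0) (x : L) :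
    LieAlgebra.rank ℝ L ≤ finrank ℝ (LinearMap.ker (LieAlgebra.ad ℝ L x)) := by
  rw [← finrank_engel_eq h]
  exact LieAlgebra.rank_le_finrank_engel ℝ x

theorem exists_finrank_ker_ad_eq_rank (h : ∀ x z : L, ⁅x, ⁅x, z⁆⁆ = 0 → ⁅x, z⁆ = 0) :
    ∃ x : L, finrank ℝ (LinearMap.ker (LieAlgebra.ad ℝ L x)) = LieAlgebra.rank ℝ L := by
  obtain ⟨x, hx⟩ := LieAlgebra.exists_isRegular ℝ L
  refine ⟨x, ?_⟩
  rw [← finrank_engel_eq h]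
  exact (LieAlgebra.isRegular_iff_finrank_engel_eq_rank ℝ x).1 hx

end Rank

set_option maxSynthPendingDepth 3

section LocalMetric

open VectorField

variable {F : Type*} [NormedAddCommGroup F] [NormedSpace ℝ F]

/-- `g` is a smooth Riemannian metric on the open subset `U` of a vector space. -/
structure IsMetricOn (g : F → F →L[ℝ] F →L[ℝ] ℝ) (U : Set F) : Prop where
  isOpen : IsOpen U
  contDiffOn : ContDiffOn ℝ ∞ g U
  symm : ∀ y ∈ U, ∀ u v, g y u v = g y v u
  pos : ∀ y ∈ U, ∀ u, u ≠ 0 → 0 < g y u u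

/-- The Christoffel symbols of the first kind as a function of the derivative of the metric. -/
def christoffelLower (T : F →L[ℝ] F →L[ℝ] F →L[ℝ] ℝ) :
    F →L[ℝ] F →L[ℝ] F →L[ℝ] ℝ :=
  (1 / 2 : ℝ) • (T + T.flip -
    ((ContinuousLinearMap.flipₗᵢ ℝ F F ℝ).toContinuousLinearEquiv.toContinuousLinearMap ∘L T.flip))

/-- The Christoffel symbols of the second kind. -/
def christoffel (g : F → F →L[ℝ] F →L[ℝ] ℝ) (y : F) : F →L[ℝ] F →L[ℝ] F :=
  (ContinuousLinearMap.compL ℝ F (F →L[ℝ] ℝ) F (g y).inverse) ∘L christoffelLower (fderiv ℝ g y)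

/-- The curvature tensor in terms of the Christoffel symbols. -/
def localCurvature (g : F → F →L[ℝ] F →L[ℝ] ℝ) (y u v w : F) : F :=
  fderiv ℝ (christoffel g) y u v w - fderiv ℝ (christoffel g) y v u w
    + christoffel g y u (christoffel g y v w) - christoffel g y v (christoffel g y u w)

namespace IsMetricOn

variable {g : F → F →L[ℝ] F →L[ℝ] ℝ} {U : Set F} (hg : IsMetricOn g U)
include hg

theorem ext_inner {y : F} (hy : y ∈ U) {u v : F} (h : ∀ z, g y u z = g y v z) : u = v := by
  by_contra huv
  have := hg.pos y hy (u - v) (sub_ne_zero.2 huv)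
  rw [(g y).map_sub, sub_apply, h, sub_self] at this
  exact this.false

theorem contDiffAt {y : F} (hy : y ∈ U) : ContDiffAt ℝ ∞ g y :=
  hg.contDiffOn.contDiffAt (hg.isOpen.mem_nhds hy)

theorem differentiableAt {y : F} (hy : y ∈ U) : DifferentiableAt ℝ g y :=
  (hg.contDiffAt hy).differentiableAt (by simp)

theorem fderiv_symm {y : F} (hy : y ∈ U) (u v w : F) :
    fderiv ℝ g y u v w = fderiv ℝ g y u w v := by
  have h := (hg.differentiableAt hy).hasFDerivAt
  have h1 := (h.clm_apply (hasFDerivAt_const v y)).clm_apply (hasFDerivAt_const w y)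
  have h2 := (h.clm_apply (hasFDerivAt_const w y)).clm_apply (hasFDerivAt_const v y)
  have h3 : (fun y ↦ g y v w) =ᶠ[nhds y] fun y ↦ g y w v := by
    filter_upwards [hg.isOpen.mem_nhds hy] with x hx using hg.symm x hx v w
  have h4 := DFunLike.congr_fun (h1.unique (h2.congr_of_eventuallyEq h3)) u
  simpa using h4

variable [FiniteDimensional ℝ F]

theorem isInvertible {y : F} (hy : y ∈ U) : (g y).IsInvertible := by
  have hinj : Function.Injective (g y) := fun u v h ↦
    hg.ext_inner hy fun z ↦ DFunLike.congr_fun h z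
  have hdim : Module.finrank ℝ F = Module.finrank ℝ (F →L[ℝ] ℝ) := by
    rw [← (LinearMap.toContinuousLinearMap (𝕜 := ℝ) (E := F) (F' := ℝ)).finrank_eq]
    exact (Subspace.dual_finrank_eq).symm
  let e := (LinearEquiv.ofInjectiveOfFinrankEq (g y : F →ₗ[ℝ] F →L[ℝ] ℝ) hinj
    hdim).toContinuousLinearEquiv
  exact ⟨e, rfl⟩

theorem apply_christoffel {y : F} (hy : y ∈ U) (u v z : F) :
    g y (christoffel g y u v) z =
      (1 / 2 : ℝ) * (fderiv ℝ g y u v z + fderiv ℝ g y v u z - fderiv ℝ g y z u v) := by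
  have : g y ((g y).inverse (christoffelLower (fderiv ℝ g y) u v)) =
      christoffelLower (fderiv ℝ g y) u v := by
    have := (hg.isInvertible hy).self_comp_inverse
    exact DFunLike.congr_fun this _
  exact DFunLike.congr_fun this z

theorem christoffel_symm {y : F} (hy : y ∈ U) (u v : F) :
    christoffel g y u v = christoffel g y v u :=
  hg.ext_inner hy fun z ↦ by
    rw [hg.apply_christoffel hy, hg.apply_christoffel hy, hg.fderiv_symm hy z u v,
      add_comm (fderiv ℝ g y u v z)]

theorem fderiv_eq {y : F} (hy : y ∈ U) (u v w : F) :
    fderiv ℝ g y u v w = g y (christoffel g y u v) w + g y v (christoffel g y u w) := by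
  rw [hg.symm y hy v, hg.apply_christoffel hy, hg.apply_christoffel hy, hg.fderiv_symm hy u w v,
    hg.fderiv_symm hy v u w, hg.fderiv_symm hy w u v]
  ring

omit [FiniteDimensional ℝ F] in
theorem contDiffOn_fderiv : ContDiffOn ℝ ∞ (fderiv ℝ g) U :=
  hg.contDiffOn.fderiv_of_isOpen hg.isOpen (by simp)

theorem contDiffOn_christoffel : ContDiffOn ℝ ∞ (christoffel g) U := by
  intro y hy
  have h1 := (hg.contDiffOn_fderiv y hy)
  have h2 : ContDiffWithinAt ℝ ∞ (fun y ↦ (g y).inverse) U y := by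
    obtain ⟨e, he⟩ := hg.isInvertible hy
    have := contDiffAt_map_inverse (𝕜 := ℝ) (n := ∞) e
    rw [he] at this
    exact this.comp_contDiffWithinAt y (hg.contDiffOn y hy)
  have hflip : ContDiffWithinAt ℝ ∞ (fun y ↦ (fderiv ℝ g y).flip) U y :=
    (ContinuousLinearMap.flipₗᵢ ℝ F F (F →L[ℝ] ℝ)).contDiff.comp_contDiffWithinAt h1
  unfold christoffel christoffelLower
  refine ContDiffWithinAt.clm_comp ?_ ?_
  · exact (ContinuousLinearMap.compL ℝ F (F →L[ℝ] ℝ) F).contDiff.comp_contDiffWithinAt h2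
  · exact ((h1.add hflip).sub (contDiffWithinAt_const.clm_comp hflip)).const_smul (1 / 2 : ℝ)

theorem hasFDerivAt_christoffel {y : F} (hy : y ∈ U) :
    HasFDerivAt (christoffel g) (fderiv ℝ (christoffel g) y) y :=
  (((hg.contDiffOn_christoffel).contDiffAt (hg.isOpen.mem_nhds hy)).differentiableAt
    (by simp)).hasFDerivAt

omit [FiniteDimensional ℝ F] in
theorem hasFDerivAt_fderiv {y : F} (hy : y ∈ U) :
    HasFDerivAt (fderiv ℝ g) (fderiv ℝ (fderiv ℝ g) y) y :=
  (((hg.contDiffOn_fderiv).contDiffAt (hg.isOpen.mem_nhds hy)).differentiableAt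
    (by simp)).hasFDerivAt

omit [FiniteDimensional ℝ F] in
theorem sndFDeriv_symm {y : F} (hy : y ∈ U) (u v : F) :
    fderiv ℝ (fderiv ℝ g) y u v = fderiv ℝ (fderiv ℝ g) y v u :=
  (hg.contDiffAt hy).isSymmSndFDerivAt
    (by rw [minSmoothness_of_isRCLikeNormedField]; exact ENat.LEInfty.out) u v

omit [FiniteDimensional ℝ F] in
theorem sndFDeriv_symm' {y : F} (hy : y ∈ U) (u v w z : F) :
    fderiv ℝ (fderiv ℝ g) y u v w z = fderiv ℝ (fderiv ℝ g) y u v z w := by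
  have h := hg.hasFDerivAt_fderiv hy
  have hc := fun x : F ↦ hasFDerivAt_const (𝕜 := ℝ) x y
  have h1 := ((h.clm_apply (hc v)).clm_apply (hc w)).clm_apply (hc z)
  have h2 := ((h.clm_apply (hc v)).clm_apply (hc z)).clm_apply (hc w)
  have h3 : (fun y ↦ fderiv ℝ g y v w z) =ᶠ[nhds y] fun y ↦ fderiv ℝ g y v z w := by
    filter_upwards [hg.isOpen.mem_nhds hy] with x hx using hg.fderiv_symm hx v w z
  have h4 := DFunLike.congr_fun (h1.unique (h2.congr_of_eventuallyEq h3)) u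
  simpa using h4

theorem apply_fderiv_christoffel {y : F} (hy : y ∈ U) (u v w z : F) :
    g y (fderiv ℝ (christoffel g) y u v w + christoffel g y u (christoffel g y v w)) z =
      (1 / 2 : ℝ) * (fderiv ℝ (fderiv ℝ g) y u v w z + fderiv ℝ (fderiv ℝ g) y u w v z
        - fderiv ℝ (fderiv ℝ g) y u z v w)
      - g y (christoffel g y v w) (christoffel g y u z) := by
  have hc := fun x : F ↦ hasFDerivAt_const (𝕜 := ℝ) x y
  have h1 := ((hg.differentiableAt hy).hasFDerivAt.clm_apply
    (((hg.hasFDerivAt_christoffel hy).clm_apply (hc v)).clm_apply (hc w))).clm_apply (hc z)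
  have h := hg.hasFDerivAt_fderiv hy
  have hh := fun a b c ↦ ((h.clm_apply (hc a)).clm_apply (hc b)).clm_apply (hc c)
  have h2 := (((hh v w z).add (hh w v z)).sub (hh z v w)).const_mul (1 / 2 : ℝ)
  have h3 : (fun y ↦ g y (christoffel g y v w) z) =ᶠ[nhds y] fun y ↦
      (1 / 2 : ℝ) * (fderiv ℝ g y v w z + fderiv ℝ g y w v z - fderiv ℝ g y z v w) := by
    filter_upwards [hg.isOpen.mem_nhds hy] with x hx using hg.apply_christoffel hx v w z
  have h4 := DFunLike.congr_fun (h1.unique (h2.congr_of_eventuallyEq h3)) u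
  have h5 := hg.fderiv_eq hy u (christoffel g y v w) z
  simp at h4
  rw [map_add, add_apply]
  linarith

theorem apply_localCurvature {y : F} (hy : y ∈ U) (u v w z : F) :
    g y (localCurvature g y u v w) z =
      (1 / 2 : ℝ) * (fderiv ℝ (fderiv ℝ g) y u w v z - fderiv ℝ (fderiv ℝ g) y u z v w
        - fderiv ℝ (fderiv ℝ g) y v w u z + fderiv ℝ (fderiv ℝ g) y v z u w)
      - g y (christoffel g y v w) (christoffel g y u z)
      + g y (christoffel g y u w) (christoffel g y v z) := by
  have h1 := hg.apply_fderiv_christoffel hy u v w z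
  have h2 := hg.apply_fderiv_christoffel hy v u w z
  have h3 := congrArg (fun T ↦ T w z) (hg.sndFDeriv_symm hy u v)
  simp only [localCurvature, map_add, map_sub, add_apply,
    sub_apply] at h1 h2 ⊢
  linarith

omit hg [FiniteDimensional ℝ F] in
theorem localCurvature_swap_left (y u v w : F) :
    localCurvature g y u v w = -localCurvature g y v u w := by
  unfold localCurvature; abel

theorem localCurvature_swap_right {y : F} (hy : y ∈ U) (u v w z : F) :
    g y (localCurvature g y u v w) z = -g y (localCurvature g y u v z) w := by
  rw [hg.apply_localCurvature hy, hg.apply_localCurvature hy, hg.symm y hy (christoffel g y v w),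
    hg.symm y hy (christoffel g y v z), hg.sndFDeriv_symm' hy u w, hg.sndFDeriv_symm' hy u z,
    hg.sndFDeriv_symm' hy v w, hg.sndFDeriv_symm' hy v z]
  have : ∀ a b c d : F, fderiv ℝ (fderiv ℝ g) y a b c d = fderiv ℝ (fderiv ℝ g) y a b d c :=
    hg.sndFDeriv_symm' hy
  linarith [this u w v z, this u z v w, this v w u z, this v z u w]

theorem localCurvature_pair_symm {y : F} (hy : y ∈ U) (u v w z : F) :
    g y (localCurvature g y u v w) z = g y (localCurvature g y w z u) v := by
  rw [hg.apply_localCurvature hy, hg.apply_localCurvature hy]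
  have h1 : ∀ a b c d : F, fderiv ℝ (fderiv ℝ g) y a b c d = fderiv ℝ (fderiv ℝ g) y b a c d :=
    fun a b c d ↦ by rw [hg.sndFDeriv_symm hy a b]
  have h2 : ∀ a b c d : F, fderiv ℝ (fderiv ℝ g) y a b c d = fderiv ℝ (fderiv ℝ g) y a b d c :=
    hg.sndFDeriv_symm' hy
  rw [hg.christoffel_symm hy z u, hg.christoffel_symm hy w v, hg.christoffel_symm hy w u,
    hg.christoffel_symm hy z v, hg.symm y hy (christoffel g y u z)]
  linarith [h1 w u z v, h2 u w z v, h1 w v z u, h2 v w z u, h1 z u w v, h2 u z w v,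
    h1 z v w u, h2 v z w u]

end IsMetricOn

/-- The covariant derivative along a map `f` of the vector field `W` along `f`, in the direction of
the vector field `X`. -/
def covariantDerivAlong {E : Type*} [NormedAddCommGroup E] [NormedSpace ℝ E]
    (g : F → F →L[ℝ] F →L[ℝ] ℝ) (f : E → F) (X : E → E) (W : E → F) (q : E) : F :=
  fderiv ℝ W q (X q) + christoffel g (f q) (fderiv ℝ f q (X q)) (W q)

section AlongMap

variable {E : Type*} [NormedAddCommGroup E] [NormedSpace ℝ E]
  {g : F → F →L[ℝ] F →L[ℝ] ℝ} {U : Set F} (hg : IsMetricOn g U)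
  {f : E → F} {q : E}

theorem hasFDerivAt_fderiv_apply {X : E → E} (hf : ContDiffAt ℝ 2 f q)
    (hX : DifferentiableAt ℝ X q) :
    HasFDerivAt (fun q ↦ fderiv ℝ f q (X q))
      ((fderiv ℝ f q) ∘L (fderiv ℝ X q) + (fderiv ℝ (fderiv ℝ f) q).flip (X q)) q :=
  (((hf.fderiv_right (m := 1) (by norm_num)).differentiableAt
    (by simp)).hasFDerivAt.clm_apply hX.hasFDerivAt)

theorem fderiv_fderiv_apply_sub {X Y : E → E} (hf : ContDiffAt ℝ 2 f q)
    (hX : DifferentiableAt ℝ X q) (hY : DifferentiableAt ℝ Y q) :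
    fderiv ℝ (fun q ↦ fderiv ℝ f q (Y q)) q (X q) -
      fderiv ℝ (fun q ↦ fderiv ℝ f q (X q)) q (Y q) = fderiv ℝ f q (lieBracket ℝ X Y q) := by
  rw [(hasFDerivAt_fderiv_apply hf hX).fderiv, (hasFDerivAt_fderiv_apply hf hY).fderiv]
  have := hf.isSymmSndFDerivAt (by simp) (X q) (Y q)
  simp only [lieBracket, map_sub, add_apply, ContinuousLinearMap.comp_apply,
    ContinuousLinearMap.flip_apply, this]
  abel

include hg

variable [FiniteDimensional ℝ F]

theorem covariantDerivAlong_sub {X Y : E → E} (hq : f q ∈ U) (hf : ContDiffAt ℝ 2 f q)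
    (hX : DifferentiableAt ℝ X q) (hY : DifferentiableAt ℝ Y q) :
    covariantDerivAlong g f X (fun q ↦ fderiv ℝ f q (Y q)) q -
      covariantDerivAlong g f Y (fun q ↦ fderiv ℝ f q (X q)) q =
      fderiv ℝ f q (lieBracket ℝ X Y q) := by
  rw [← fderiv_fderiv_apply_sub hf hX hY]
  simp only [covariantDerivAlong, hg.christoffel_symm hq (fderiv ℝ f q (Y q))]
  abel

theorem fderiv_metric_apply {X : E → E} {V W : E → F} (hq : f q ∈ U)
    (hf : DifferentiableAt ℝ f q) (hV : DifferentiableAt ℝ V q) (hW : DifferentiableAt ℝ W q) :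
    fderiv ℝ (fun q ↦ g (f q) (V q) (W q)) q (X q) =
      g (f q) (covariantDerivAlong g f X V q) (W q) +
        g (f q) (V q) (covariantDerivAlong g f X W q) := by
  have h := ((((hg.differentiableAt hq).hasFDerivAt.comp q hf.hasFDerivAt).clm_apply
    hV.hasFDerivAt).clm_apply hW.hasFDerivAt)
  have h1 := DFunLike.congr_fun h.fderiv (X q)
  have h2 := hg.fderiv_eq hq (fderiv ℝ f q (X q)) (V q) (W q)
  simp only [Function.comp_apply] at h1
  rw [h1]
  simp [covariantDerivAlong, h2]
  ring

theorem covariantDerivAlong_commutator {X Y : E → E} {W : E → F} (hq : f q ∈ U)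
    (hf : ContDiffAt ℝ 2 f q) (hX : DifferentiableAt ℝ X q) (hY : DifferentiableAt ℝ Y q)
    (hW : ContDiffAt ℝ 2 W q) :
    covariantDerivAlong g f X (covariantDerivAlong g f Y W) q -
      covariantDerivAlong g f Y (covariantDerivAlong g f X W) q -
      covariantDerivAlong g f (lieBracket ℝ X Y) W q =
    localCurvature g (f q) (fderiv ℝ f q (X q)) (fderiv ℝ f q (Y q)) (W q) := by
  have hW' := (hW.differentiableAt (by simp)).hasFDerivAt
  have hf' := (hf.differentiableAt (by simp)).hasFDerivAt
  have key : ∀ Z : E → E, DifferentiableAt ℝ Z q →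
      HasFDerivAt (covariantDerivAlong g f Z W) _ q := fun Z hZ ↦
    (hasFDerivAt_fderiv_apply hW hZ).add
      ((((hg.hasFDerivAt_christoffel hq).comp q hf').clm_apply
        (hasFDerivAt_fderiv_apply hf hZ)).clm_apply hW')
  have h1 := DFunLike.congr_fun (key X hX).fderiv (Y q)
  have h2 := DFunLike.congr_fun (key Y hY).fderiv (X q)
  have h3 := hf.isSymmSndFDerivAt (by simp) (X q) (Y q)
  have h4 := hW.isSymmSndFDerivAt (by simp) (X q) (Y q)
  rw [show covariantDerivAlong g f X (covariantDerivAlong g f Y W) q = fderiv ℝ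
      (covariantDerivAlong g f Y W) q (X q) + christoffel g (f q) (fderiv ℝ f q (X q))
        (covariantDerivAlong g f Y W q) from rfl, h2,
    show covariantDerivAlong g f Y (covariantDerivAlong g f X W) q = fderiv ℝ
      (covariantDerivAlong g f X W) q (Y q) + christoffel g (f q) (fderiv ℝ f q (Y q))
        (covariantDerivAlong g f X W q) from rfl, h1]
  simp [covariantDerivAlong, localCurvature, lieBracket, h3, h4]
  abel

end AlongMap

/-- The vector fields `X x` on `N`, closed under the Lie bracket, are such that the metric pulled
back by `f` has constant coefficients. -/
structure IsConstantFrame {E : Type*} [NormedAddCommGroup E] [NormedSpace ℝ E]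
    (g : F → F →L[ℝ] F →L[ℝ] ℝ) (U : Set F) (f : E → F) (N : Set E) {𝔤 : Type*} (X : 𝔤 → E → E)
    (b : 𝔤 → 𝔤 → 𝔤) (h : 𝔤 → 𝔤 → ℝ) : Prop where
  isOpen : IsOpen N
  mapsTo : Set.MapsTo f N U
  contDiffOn : ContDiffOn ℝ ∞ f N
  contDiffOn_frame : ∀ x, ContDiffOn ℝ 2 (X x) N
  lieBracket_eq : ∀ x y, ∀ q ∈ N, lieBracket ℝ (X x) (X y) q = X (b x y) q
  metric_eq : ∀ x y, ∀ q ∈ N, g (f q) (fderiv ℝ f q (X x q)) (fderiv ℝ f q (X y q)) = h x y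
  surjective : ∀ q ∈ N, ∀ u, ∃ w, fderiv ℝ f q (X w q) = u

namespace IsConstantFrame

variable {E : Type*} [NormedAddCommGroup E] [NormedSpace ℝ E]
  {g : F → F →L[ℝ] F →L[ℝ] ℝ} {U : Set F} (hg : IsMetricOn g U)
  {f : E → F} {N : Set E} {𝔤 : Type*} {X : 𝔤 → E → E} {b : 𝔤 → 𝔤 → 𝔤} {h : 𝔤 → 𝔤 → ℝ}
  (hX : IsConstantFrame g U f N X b h)

include hX

theorem contDiffAt {q : E} (hq : q ∈ N) : ContDiffAt ℝ ∞ f q :=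
  hX.contDiffOn.contDiffAt (hX.isOpen.mem_nhds hq)

theorem contDiffAt_frame {q : E} (hq : q ∈ N) (x : 𝔤) : ContDiffAt ℝ 2 (X x) q :=
  (hX.contDiffOn_frame x).contDiffAt (hX.isOpen.mem_nhds hq)

theorem contDiffAt_image {q : E} (hq : q ∈ N) (x : 𝔤) :
    ContDiffAt ℝ 2 (fun q ↦ fderiv ℝ f q (X x q)) q :=
  ((hX.contDiffAt hq).fderiv_right (m := 2)
    (by rw [show (2 : WithTop ℕ∞) + 1 = 3 by norm_num]; exact ENat.LEInfty.out)).clm_apply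
      (hX.contDiffAt_frame hq x)

include hg

variable [FiniteDimensional ℝ F]

theorem two_mul_metric_covariantDerivAlong {q : E} (hq : q ∈ N) (x y w : 𝔤) :
    2 * g (f q) (covariantDerivAlong g f (X x) (fun q ↦ fderiv ℝ f q (X y q)) q)
        (fderiv ℝ f q (X w q)) =
      h (b x y) w + h (b w y) x - h (b x w) y := by
  have hf2 : ContDiffAt ℝ 2 f q := (hX.contDiffAt hq).of_le ENat.LEInfty.out
  have hd := fun x ↦ (hX.contDiffAt_frame hq x).differentiableAt (by simp)
  have hc : ∀ x y w : 𝔤,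
      g (f q) (covariantDerivAlong g f (X x) (fun q ↦ fderiv ℝ f q (X y q)) q)
        (fderiv ℝ f q (X w q)) =
      -g (f q) (covariantDerivAlong g f (X x) (fun q ↦ fderiv ℝ f q (X w q)) q)
        (fderiv ℝ f q (X y q)) := by
    intro x y w
    have h1 := fderiv_metric_apply hg (X := X x) (hX.mapsTo hq) (hf2.differentiableAt (by simp))
      ((hX.contDiffAt_image hq y).differentiableAt (by simp))
      ((hX.contDiffAt_image hq w).differentiableAt (by simp))
    have h2 : (fun q ↦ g (f q) (fderiv ℝ f q (X y q)) (fderiv ℝ f q (X w q))) =ᶠ[nhds q]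
        fun _ ↦ h y w := by
      filter_upwards [hX.isOpen.mem_nhds hq] with p hp using hX.metric_eq y w p hp
    rw [h2.fderiv_eq, fderiv_const_apply, zero_apply,
      hg.symm _ (hX.mapsTo hq) (fderiv ℝ f q (X y q))] at h1
    linarith
  have ht : ∀ x y w : 𝔤,
      g (f q) (covariantDerivAlong g f (X x) (fun q ↦ fderiv ℝ f q (X y q)) q)
        (fderiv ℝ f q (X w q)) =
      g (f q) (covariantDerivAlong g f (X y) (fun q ↦ fderiv ℝ f q (X x q)) q)
        (fderiv ℝ f q (X w q)) + h (b x y) w := by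
    intro x y w
    have h1 := covariantDerivAlong_sub hg (hX.mapsTo hq) hf2 (hd x) (hd y)
    rw [sub_eq_iff_eq_add, hX.lieBracket_eq x y q hq] at h1
    rw [h1, map_add, add_apply, hX.metric_eq _ _ q hq, add_comm]
  linarith [hc x y w, ht x w y, hc w x y, ht w y x, hc y w x, ht x y w]

theorem covariantDerivAlong_eq {y z a : 𝔤}
    (ha : ∀ w, 2 * h a w = h (b y z) w + h (b w z) y - h (b y w) z) {q : E} (hq : q ∈ N) :
    covariantDerivAlong g f (X y) (fun q ↦ fderiv ℝ f q (X z q)) q = fderiv ℝ f q (X a q) := by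
  refine hg.ext_inner (hX.mapsTo hq) fun u ↦ ?_
  obtain ⟨w, rfl⟩ := hX.surjective q hq u
  rw [hX.metric_eq _ _ q hq]
  linarith [hX.two_mul_metric_covariantDerivAlong hg hq y z w, ha w]

/-- The curvature in terms of the constant coefficients of the metric. -/
theorem two_mul_metric_localCurvature {x y z a c : 𝔤}
    (ha : ∀ w, 2 * h a w = h (b y z) w + h (b w z) y - h (b y w) z)
    (hc : ∀ w, 2 * h c w = h (b x z) w + h (b w z) x - h (b x w) z) (w : 𝔤) {q : E} (hq : q ∈ N) :
    2 * g (f q) (localCurvature g (f q) (fderiv ℝ f q (X x q)) (fderiv ℝ f q (X y q))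
        (fderiv ℝ f q (X z q))) (fderiv ℝ f q (X w q)) =
      (h (b x a) w + h (b w a) x - h (b x w) a) - (h (b y c) w + h (b w c) y - h (b y w) c)
        - (h (b (b x y) z) w + h (b w z) (b x y) - h (b (b x y) w) z) := by
  have hf2 : ContDiffAt ℝ 2 f q := (hX.contDiffAt hq).of_le ENat.LEInfty.out
  have hd := fun x ↦ (hX.contDiffAt_frame hq x).differentiableAt (by simp)
  have hcongr : ∀ {y z a : 𝔤} (x : 𝔤),
      (∀ w, 2 * h a w = h (b y z) w + h (b w z) y - h (b y w) z) →
      covariantDerivAlong g f (X x)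
        (covariantDerivAlong g f (X y) (fun q ↦ fderiv ℝ f q (X z q))) q =
      covariantDerivAlong g f (X x) (fun q ↦ fderiv ℝ f q (X a q)) q := by
    intro y z a x ha
    have h1 : covariantDerivAlong g f (X y) (fun q ↦ fderiv ℝ f q (X z q)) =ᶠ[nhds q]
        fun q ↦ fderiv ℝ f q (X a q) := by
      filter_upwards [hX.isOpen.mem_nhds hq] with p hp using hX.covariantDerivAlong_eq hg ha hp
    rw [covariantDerivAlong, h1.fderiv_eq, h1.eq_of_nhds]
    rfl
  rw [← covariantDerivAlong_commutator hg (hX.mapsTo hq) hf2 (hd x) (hd y)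
    (hX.contDiffAt_image hq z), hcongr x ha, hcongr y hc]
  have h2 : covariantDerivAlong g f (lieBracket ℝ (X x) (X y)) (fun q ↦ fderiv ℝ f q (X z q)) q =
      covariantDerivAlong g f (X (b x y)) (fun q ↦ fderiv ℝ f q (X z q)) q := by
    simp only [covariantDerivAlong, hX.lieBracket_eq x y q hq]
  rw [h2]
  simp only [map_sub, sub_apply, mul_sub, hX.two_mul_metric_covariantDerivAlong hg hq]

end IsConstantFrame

end LocalMetric

section Chart

open VectorField

variable {E : Type*} [NormedAddCommGroup E] [NormedSpace ℝ E]
  {H : Type*} [TopologicalSpace H] (I : ModelWithCorners ℝ E H)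
  {M : Type*} [TopologicalSpace M] [ChartedSpace H M]

/-- The derivative of the inverse of the chart at `b`. -/
def chartTangent (b : M) (y : E) : E →L[ℝ] TangentSpace I ((extChartAt I b).symm y) :=
  mfderiv 𝓘(ℝ, E) I (extChartAt I b).symm y

/-- The vector field `X` in the chart at `b`. -/
def chartField (b : M) (X : Π x : M, TangentSpace I x) : E → E :=
  mpullback 𝓘(ℝ, E) I (extChartAt I b).symm X

/-- The metric in the chart at `b`. -/
def chartMetric [RiemannianBundle (fun x : M ↦ TangentSpace I x)] (b : M) (y : E) :
    E →L[ℝ] E →L[ℝ] ℝ :=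
  (innerSL ℝ : TangentSpace I ((extChartAt I b).symm y) →L[ℝ] _).bilinearComp
    (chartTangent I b y) (chartTangent I b y)

theorem chartMetric_apply [RiemannianBundle (fun x : M ↦ TangentSpace I x)] (b : M) (y u v : E) :
    chartMetric I b y u v = inner ℝ (chartTangent I b y u) (chartTangent I b y v) := rfl

variable [IsManifold I ∞ M] [I.Boundaryless]

theorem contMDiffAt_extChartAt_symm {b : M} {y : E} (hy : y ∈ (extChartAt I b).target) :
    ContMDiffAt 𝓘(ℝ, E) I ∞ (extChartAt I b).symm y :=
  (contMDiffOn_extChartAt_symm b).contMDiffAt ((isOpen_extChartAt_target b).mem_nhds hy)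

theorem isInvertible_chartTangent {b : M} {y : E} (hy : y ∈ (extChartAt I b).target) :
    (chartTangent I b y).IsInvertible := by
  have := isInvertible_mfderivWithin_extChartAt_symm (I := I) hy
  rwa [I.range_eq_univ, mfderivWithin_univ] at this

theorem chartTangent_chartField {b : M} (X : Π x : M, TangentSpace I x) {y : E}
    (hy : y ∈ (extChartAt I b).target) :
    chartTangent I b y (chartField I b X y) = X ((extChartAt I b).symm y) :=
  DFunLike.congr_fun (isInvertible_chartTangent I hy).self_comp_inverse _

theorem chartField_chartTangent {b : M} (X : Π x : M, TangentSpace I x) {y u : E}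
    (hy : y ∈ (extChartAt I b).target) (h : X ((extChartAt I b).symm y) = chartTangent I b y u) :
    chartField I b X y = u := by
  rw [chartField, mpullback_apply, h]
  exact DFunLike.congr_fun (isInvertible_chartTangent I hy).inverse_comp_self _

theorem differentiableAt_chartField [CompleteSpace E] {b : M} {X : Π x : M, TangentSpace I x}
    {y : E} (hy : y ∈ (extChartAt I b).target)
    (hX : MDifferentiableAt I I.tangent (fun x ↦ (X x : TangentBundle I M))
      ((extChartAt I b).symm y)) : DifferentiableAt ℝ (chartField I b X) y := by
  have h1 := hX.mpullback_vectorField (contMDiffAt_extChartAt_symm I hy)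
    (isInvertible_chartTangent I hy) ENat.LEInfty.out
  have h2 := (contMDiff_snd_tangentBundle_modelSpace E 𝓘(ℝ, E)).contMDiffAt.mdifferentiableAt
    one_ne_zero |>.comp y h1
  exact h2.differentiableAt

omit [TopologicalSpace H] in
theorem mdifferentiableAt_section_vectorSpace {V : E → E} {y : E} (hV : DifferentiableAt ℝ V y) :
    MDifferentiableAt 𝓘(ℝ, E) 𝓘(ℝ, E).tangent
      (fun y ↦ (⟨y, V y⟩ : TangentBundle 𝓘(ℝ, E) E)) y := by
  have h := mdifferentiableAt_section (IB := 𝓘(ℝ, E)) (F := E) (E := TangentSpace 𝓘(ℝ, E))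
    (fun y ↦ (V y : TangentSpace 𝓘(ℝ, E) y)) (b₀ := y)
  refine h.2 ?_
  simpa using hV.mdifferentiableAt

theorem chartField_extChartAt {b z : M} (X : Π x : M, TangentSpace I x)
    (hz : z ∈ (extChartAt I b).source) :
    chartField I b X (extChartAt I b z) = mfderiv I 𝓘(ℝ, E) (extChartAt I b) z (X z) := by
  have h3 := mfderivWithin_extChartAt_symm_comp_mfderiv_extChartAt' (I := I) hz
  rw [I.range_eq_univ, mfderivWithin_univ] at h3
  refine chartField_chartTangent I _ ((extChartAt I b).map_source hz) ?_
  have h5 : ∀ z', z' = z → (X z' : E) = (X z : E) := by rintro _ rfl; rfl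
  exact (h5 _ ((extChartAt I b).left_inv hz)).trans (DFunLike.congr_fun h3 (X z)).symm

theorem eventuallyEq_mpullback_chartField {b x : M} (X : Π x : M, TangentSpace I x)
    (hx : x ∈ (extChartAt I b).source) :
    X =ᶠ[nhds x] mpullback I 𝓘(ℝ, E) (extChartAt I b) (chartField (E := E) I b X) := by
  filter_upwards [(isOpen_extChartAt_source b).mem_nhds hx] with z hz
  have h1 := chartField_extChartAt I X hz
  have h2 := (isInvertible_mfderiv_extChartAt (I := I) hz).inverse_comp_self
  have h3 : mpullback I 𝓘(ℝ, E) (extChartAt I b) (chartField (E := E) I b X) z =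
    (mfderiv I 𝓘(ℝ, E) (extChartAt I b) z).inverse
      (chartField (E := E) I b X (extChartAt I b z)) := rfl
  rw [h3]
  exact (DFunLike.congr_fun h2 (X z)).symm.trans (congrArg _ h1.symm)

theorem mdifferentiableAt_of_chartField [CompleteSpace E] {b x : M} {X : Π x : M, TangentSpace I x}
    (hx : x ∈ (extChartAt I b).source)
    (hX : DifferentiableAt ℝ (chartField I b X) (extChartAt I b x)) :
    MDifferentiableAt I I.tangent (fun x ↦ (X x : TangentBundle I M)) x := by
  have h1 : MDifferentiableAt 𝓘(ℝ, E) 𝓘(ℝ, E).tangent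
      (fun y ↦ (⟨y, chartField (E := E) I b X y⟩ : TangentBundle 𝓘(ℝ, E) E)) (extChartAt I b x) :=
    mdifferentiableAt_section_vectorSpace hX
  have h2 := h1.mpullback_vectorField (n := ∞)
    (contMDiffAt_extChartAt' (by simpa using hx))
    (isInvertible_mfderiv_extChartAt hx) ENat.LEInfty.out
  refine h2.congr_of_eventuallyEq ?_
  filter_upwards [eventuallyEq_mpullback_chartField I X hx] with z hz
  exact congrArg (fun v ↦ (⟨z, v⟩ : TangentBundle I M)) hz

theorem contDiffAt_chartField [CompleteSpace E] {b : M} {X : Π x : M, TangentSpace I x} {y : E}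
    (hy : y ∈ (extChartAt I b).target)
    (hX : ContMDiffAt I I.tangent 2 (fun x ↦ (X x : TangentBundle I M))
      ((extChartAt I b).symm y)) : ContDiffAt ℝ 2 (chartField I b X) y := by
  have h1 := hX.mpullback_vectorField_preimage (contMDiffAt_extChartAt_symm I hy)
    (isInvertible_chartTangent I hy)
    (by rw [show (2 : WithTop ℕ∞) + 1 = 3 by norm_num]; exact ENat.LEInfty.out)
  exact contMDiffAt_vectorSpace_iff_contDiffAt.1 h1

theorem mvfderiv_apply_eq {b : M} {y : E} (X : Π x : M, TangentSpace I x) {f : M → ℝ}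
    (hy : y ∈ (extChartAt I b).target)
    (hf : MDifferentiableAt I 𝓘(ℝ, ℝ) f ((extChartAt I b).symm y)) :
    mvfderiv I f ((extChartAt I b).symm y) (X ((extChartAt I b).symm y)) =
      fderiv ℝ (f ∘ (extChartAt I b).symm) y (chartField I b X y) := by
  have h1 := mfderiv_comp y hf ((contMDiffAt_extChartAt_symm I hy).mdifferentiableAt (by simp))
  rw [mfderiv_eq_fderiv] at h1
  rw [← chartTangent_chartField I X hy]
  exact (DFunLike.congr_fun h1 (chartField I b X y)).symm

theorem chartField_mlieBracket [CompleteSpace E] {b : M} {X Y : Π x : M, TangentSpace I x} {y : E}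
    (hy : y ∈ (extChartAt I b).target)
    (hX : MDifferentiableAt I I.tangent (fun x ↦ (X x : TangentBundle I M))
      ((extChartAt I b).symm y))
    (hY : MDifferentiableAt I I.tangent (fun x ↦ (Y x : TangentBundle I M))
      ((extChartAt I b).symm y)) :
    chartField I b (mlieBracket I X Y) y =
      lieBracket ℝ (chartField I b X) (chartField I b Y) y := by
  have h : minSmoothness ℝ 2 ≤ (∞ : WithTop ℕ∞) := by
    rw [minSmoothness_of_isRCLikeNormedField]; exact ENat.LEInfty.out
  have : IsManifold I (minSmoothness ℝ 2) M := IsManifold.of_le h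
  have := mpullback_mlieBracket (n := ∞) hX hY (contMDiffAt_extChartAt_symm I hy) h
  rw [chartField, this, ← mlieBracketWithin_univ, mlieBracketWithin_eq_lieBracketWithin]
  exact congrFun (lieBracketWithin_univ (V := chartField I b X) (W := chartField I b Y)) y

theorem chartField_extend {b : M} (u : TangentSpace I b) {y : E}
    (hy : y ∈ (extChartAt I b).target) :
    chartField I b (FiberBundle.extend E u) y =
      chartField I b (FiberBundle.extend E u) (extChartAt I b b) := by
  have key : ∀ y ∈ (extChartAt I b).target, chartField I b (FiberBundle.extend E u) y =
      (trivializationAt E (TangentSpace I) b ⟨b, u⟩).2 := by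
    intro y hy
    refine chartField_chartTangent I _ hy ?_
    have h1 : (extChartAt I b).symm y ∈ (chartAt H b).source := by
      simpa using (extChartAt I b).map_target hy
    have h2 := TangentBundle.symmL_trivializationAt (I := I) h1
    rw [I.range_eq_univ, mfderivWithin_univ, (extChartAt I b).right_inv hy] at h2
    rw [chartTangent, ← h2]
    exact (Trivialization.symmL_apply _ (by simpa using h1) _).symm
  rw [key y hy, key _ (mem_extChartAt_target b)]

theorem contMDiffAt_chartTangent {b : M} (u : E) {y : E} (hy : y ∈ (extChartAt I b).target) :
    ContMDiffAt 𝓘(ℝ, E) I.tangent ∞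
      (fun y ↦ (⟨(extChartAt I b).symm y, chartTangent I b y u⟩ : TangentBundle I M)) y := by
  have h1 : ContMDiffOn 𝓘(ℝ, E).tangent I.tangent ∞ _ _ :=
    (contMDiffOn_extChartAt_symm (I := I) (n := ∞) b).contMDiffOn_tangentMapWithin (m := ∞)
      (by simp) (isOpen_extChartAt_target b).uniqueMDiffOn
  have h2 : ContMDiffAt 𝓘(ℝ, E) 𝓘(ℝ, E).tangent ∞
      (fun y : E ↦ (⟨y, u⟩ : TangentBundle 𝓘(ℝ, E) E)) y :=
    contMDiffAt_vectorSpace_iff_contDiffAt.2 contDiffAt_const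
  have hmem := (isOpen_extChartAt_target (I := I) b).mem_nhds hy
  have h3 := (h1 ⟨y, u⟩ hy).contMDiffAt
    ((FiberBundle.continuous_proj E (TangentSpace 𝓘(ℝ, E))).continuousAt.preimage_mem_nhds hmem)
  refine (h3.comp y h2).congr_of_eventuallyEq ?_
  filter_upwards [hmem] with z hz
  simp only [Function.comp_apply, tangentMapWithin]
  rw [mfderivWithin_eq_mfderiv ((isOpen_extChartAt_target b).uniqueMDiffWithinAt hz)
    ((contMDiffAt_extChartAt_symm I hz).mdifferentiableAt (by simp))]
  rfl

theorem isMetricOn_chartMetric [FiniteDimensional ℝ E]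
    [RiemannianBundle (fun x : M ↦ TangentSpace I x)]
    [IsContMDiffRiemannianBundle I ∞ E (fun x : M ↦ TangentSpace I x)] (b : M) :
    IsMetricOn (chartMetric I b) (extChartAt I b).target := by
  refine ⟨isOpen_extChartAt_target b, ?_, fun y _ u v ↦ ?_, fun y hy u hu ↦ ?_⟩
  · rw [contDiffOn_clm_apply]
    intro u
    rw [contDiffOn_clm_apply]
    intro v y hy
    have h := ContMDiffAt.inner_bundle (IB := I) (F := E) (E := fun x : M ↦ TangentSpace I x)
      (b := (extChartAt I b).symm) (v := fun y ↦ chartTangent I b y u)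
      (w := fun y ↦ chartTangent I b y v) (contMDiffAt_chartTangent I u hy)
      (contMDiffAt_chartTangent I v hy)
    exact h.contDiffAt.contDiffWithinAt
  · rw [chartMetric_apply, chartMetric_apply]; exact real_inner_comm _ _
  · rw [chartMetric_apply, real_inner_self_eq_norm_sq]
    refine pow_pos (norm_pos_iff.2 fun h ↦ hu ?_) 2
    have := (isInvertible_chartTangent I hy).injective
    exact this (h.trans (map_zero _).symm)

end Chart

section LeviCivita

open VectorField

variable {E : Type*} [NormedAddCommGroup E] [NormedSpace ℝ E] [FiniteDimensional ℝ E]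
  {H : Type*} [TopologicalSpace H] (I : ModelWithCorners ℝ E H) [I.Boundaryless]
  {M : Type*} [TopologicalSpace M] [ChartedSpace H M] [IsManifold I ∞ M]
  [RiemannianBundle (fun x : M ↦ TangentSpace I x)]

omit [FiniteDimensional ℝ E] in
theorem chartMetric_chartField {b : M} (X Y : Π x : M, TangentSpace I x) {y : E}
    (hy : y ∈ (extChartAt I b).target) :
    chartMetric I b y (chartField I b X y) (chartField I b Y y) =
      inner ℝ (X ((extChartAt I b).symm y)) (Y ((extChartAt I b).symm y)) := by
  rw [chartMetric_apply, chartTangent_chartField I X hy, chartTangent_chartField I Y hy]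

omit [FiniteDimensional ℝ E] in
theorem chartMetric_mfderiv {b x : M} (hx : x ∈ (extChartAt I b).source) (u v : TangentSpace I x) :
    chartMetric I b (extChartAt I b x) (mfderiv I 𝓘(ℝ, E) (extChartAt I b) x u)
      (mfderiv I 𝓘(ℝ, E) (extChartAt I b) x v) = inner ℝ u v := by
  have h1 := chartField_extChartAt I (FiberBundle.extend E u) hx
  have h2 := chartField_extChartAt I (FiberBundle.extend E v) hx
  have h3 := chartMetric_chartField I (FiberBundle.extend E u) (FiberBundle.extend E v)
    ((extChartAt I b).map_source hx)
  rw [FiberBundle.extend_apply_self] at h1 h2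
  rw [h1, h2] at h3
  refine h3.trans ?_
  have h5 : ∀ z', z' = x → (inner ℝ (FiberBundle.extend E u z') (FiberBundle.extend E v z') : ℝ) =
      inner ℝ u v := by
    rintro _ rfl
    rw [FiberBundle.extend_apply_self, FiberBundle.extend_apply_self]
  exact h5 _ ((extChartAt I b).left_inv hx)

variable [IsContMDiffRiemannianBundle I ∞ E (fun x : M ↦ TangentSpace I x)]

theorem mvfderiv_inner {b : M} {X Y Z : Π x : M, TangentSpace I x} {y : E}
    (hy : y ∈ (extChartAt I b).target)
    (hY : MDifferentiableAt I I.tangent (fun x ↦ (Y x : TangentBundle I M))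
      ((extChartAt I b).symm y))
    (hZ : MDifferentiableAt I I.tangent (fun x ↦ (Z x : TangentBundle I M))
      ((extChartAt I b).symm y)) :
    mvfderiv I (fun x ↦ inner ℝ (Y x) (Z x)) ((extChartAt I b).symm y)
      (X ((extChartAt I b).symm y)) =
    chartMetric I b y
      (covariantDerivAlong (chartMetric I b) id (chartField I b X) (chartField I b Y) y)
      (chartField I b Z y) +
    chartMetric I b y (chartField I b Y y)
      (covariantDerivAlong (chartMetric I b) id (chartField I b X) (chartField I b Z) y) := by
  have : CompleteSpace E := FiniteDimensional.complete ℝ E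
  have hcont : IsContMDiffRiemannianBundle I 1 E (fun x : M ↦ TangentSpace I x) :=
    inferInstance
  have hi : MDifferentiableAt I 𝓘(ℝ, ℝ) (fun x ↦ (inner ℝ (Y x) (Z x) : ℝ))
      ((extChartAt I b).symm y) :=
    MDifferentiableAt.inner_bundle (IB := I) (F := E) (E := fun x : M ↦ TangentSpace I x) hY hZ
  rw [mvfderiv_apply_eq I X hy hi]
  have h1 : (fun x ↦ (inner ℝ (Y x) (Z x) : ℝ)) ∘ (extChartAt I b).symm =ᶠ[nhds y]
      fun y ↦ chartMetric I b (id y) (chartField I b Y y) (chartField I b Z y) := by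
    filter_upwards [(isOpen_extChartAt_target b).mem_nhds hy] with z hz
    exact (chartMetric_chartField I Y Z hz).symm
  rw [h1.fderiv_eq]
  exact fderiv_metric_apply (isMetricOn_chartMetric I b) (f := id) hy differentiableAt_id
    (differentiableAt_chartField I hy hY) (differentiableAt_chartField I hy hZ)

theorem inner_mlieBracket {b : M} {X Y Z : Π x : M, TangentSpace I x} {y : E}
    (hy : y ∈ (extChartAt I b).target)
    (hX : MDifferentiableAt I I.tangent (fun x ↦ (X x : TangentBundle I M))
      ((extChartAt I b).symm y))
    (hY : MDifferentiableAt I I.tangent (fun x ↦ (Y x : TangentBundle I M))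
      ((extChartAt I b).symm y)) :
    inner ℝ (mlieBracket I X Y ((extChartAt I b).symm y)) (Z ((extChartAt I b).symm y)) =
    chartMetric I b y
      (covariantDerivAlong (chartMetric I b) id (chartField I b X) (chartField I b Y) y)
      (chartField I b Z y) -
    chartMetric I b y
      (covariantDerivAlong (chartMetric I b) id (chartField I b Y) (chartField I b X) y)
      (chartField I b Z y) := by
  have : CompleteSpace E := FiniteDimensional.complete ℝ E
  have h := covariantDerivAlong_sub (isMetricOn_chartMetric I b) (f := id) (q := y) hy
    contDiffAt_id (differentiableAt_chartField I hy hX) (differentiableAt_chartField I hy hY)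
  simp only [fderiv_id, ContinuousLinearMap.id_apply] at h
  rw [← chartMetric_chartField I _ _ hy, chartField_mlieBracket I hy hX hY, ← h]
  simp

theorem koszul_eq {b : M} {X Y Z : Π x : M, TangentSpace I x} {y : E}
    (hy : y ∈ (extChartAt I b).target)
    (hX : MDifferentiableAt I I.tangent (fun x ↦ (X x : TangentBundle I M))
      ((extChartAt I b).symm y))
    (hY : MDifferentiableAt I I.tangent (fun x ↦ (Y x : TangentBundle I M))
      ((extChartAt I b).symm y))
    (hZ : MDifferentiableAt I I.tangent (fun x ↦ (Z x : TangentBundle I M))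
      ((extChartAt I b).symm y)) :
    koszul I X Y Z ((extChartAt I b).symm y) =
    chartMetric I b y
      (covariantDerivAlong (chartMetric I b) id (chartField I b X) (chartField I b Y) y)
      (chartField I b Z y) := by
  have hs := (isMetricOn_chartMetric I b).symm y hy
  rw [koszul, mvfderiv_inner I hy hY hZ, mvfderiv_inner I hy hX hZ, mvfderiv_inner I hy hX hY,
    inner_mlieBracket I hy hX hY, inner_mlieBracket I hy hX hZ, inner_mlieBracket I hy hY hZ,
    hs (chartField I b Y y), hs (chartField I b X y), hs (chartField I b X y)]
  ring

theorem leviCivita_eq {b : M} {X Y : Π x : M, TangentSpace I x} {y : E}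
    (hy : y ∈ (extChartAt I b).target)
    (hX : MDifferentiableAt I I.tangent (fun x ↦ (X x : TangentBundle I M))
      ((extChartAt I b).symm y))
    (hY : MDifferentiableAt I I.tangent (fun x ↦ (Y x : TangentBundle I M))
      ((extChartAt I b).symm y)) :
    leviCivita I X Y ((extChartAt I b).symm y) = chartTangent I b y
      (covariantDerivAlong (chartMetric I b) id (chartField I b X) (chartField I b Y) y) := by
  have key : ∀ z : TangentSpace I ((extChartAt I b).symm y), inner ℝ (chartTangent I b y
      (covariantDerivAlong (chartMetric I b) id (chartField I b X) (chartField I b Y) y)) z =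
      koszul I X Y (FiberBundle.extend E z) ((extChartAt I b).symm y) := by
    intro z
    rw [koszul_eq I hy hX hY (FiberBundle.mdifferentiableAt_extend I E z), chartMetric_apply,
      chartTangent_chartField I _ hy, FiberBundle.extend_apply_self]
  have hex : ∃! u : TangentSpace I ((extChartAt I b).symm y),
      ∀ z : TangentSpace I ((extChartAt I b).symm y), inner ℝ u z =
        koszul I X Y (FiberBundle.extend E z) ((extChartAt I b).symm y) :=
    ⟨_, key, fun u hu ↦ ext_inner_right ℝ fun z ↦ (hu z).trans (key z).symm⟩
  rw [leviCivita, dif_pos hex]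
  exact ext_inner_right ℝ fun z ↦ (hex.choose_spec.1 z).trans (key z).symm

theorem chartField_leviCivita {b : M} {X Y : Π x : M, TangentSpace I x} {y : E}
    (hy : y ∈ (extChartAt I b).target)
    (hX : MDifferentiableAt I I.tangent (fun x ↦ (X x : TangentBundle I M))
      ((extChartAt I b).symm y))
    (hY : MDifferentiableAt I I.tangent (fun x ↦ (Y x : TangentBundle I M))
      ((extChartAt I b).symm y)) :
    chartField I b (leviCivita I X Y) y =
      covariantDerivAlong (chartMetric I b) id (chartField I b X) (chartField I b Y) y :=
  chartField_chartTangent I _ hy (leviCivita_eq I hy hX hY)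

/-- The derivative of the chart at `b`. -/
def toChart (b : M) : TangentSpace I b →L[ℝ] E := mfderiv I 𝓘(ℝ, E) (extChartAt I b) b

omit [FiniteDimensional ℝ E] [RiemannianBundle (fun x : M ↦ TangentSpace I x)]
  [IsContMDiffRiemannianBundle I ∞ E (fun x : M ↦ TangentSpace I x)] in
theorem chartField_eq_toChart {b : M} (X : Π x : M, TangentSpace I x) :
    chartField I b X (extChartAt I b b) = toChart I b (X b) :=
  chartField_extChartAt I X (mem_extChartAt_source b)

omit [FiniteDimensional ℝ E]
  [IsContMDiffRiemannianBundle I ∞ E (fun x : M ↦ TangentSpace I x)] in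
theorem chartMetric_toChart {b : M} (u v : TangentSpace I b) :
    chartMetric I b (extChartAt I b b) (toChart I b u) (toChart I b v) = inner ℝ u v :=
  chartMetric_mfderiv I (mem_extChartAt_source b) u v

omit [FiniteDimensional ℝ E] in
theorem isLinearMap_localCurvature (g : E → E →L[ℝ] E →L[ℝ] ℝ) (y v w z : E) :
    IsLinearMap ℝ fun u ↦ g y (localCurvature g y u v w) z := by
  constructor
  · intro u u'
    simp only [localCurvature, map_add, map_sub, add_apply, sub_apply]
    ring
  · intro c u
    simp only [localCurvature, map_add, map_sub, add_apply, sub_apply, map_smul, smul_apply,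
      smul_eq_mul]
    ring

theorem toChart_curvature {b : M} (u v w : TangentSpace I b) :
    toChart I b (curvature I u v w) =
    localCurvature (chartMetric I b) (extChartAt I b b)
      (toChart I b u) (toChart I b v)
      (toChart I b w) := by
  have : CompleteSpace E := FiniteDimensional.complete ℝ E
  have hb := mem_extChartAt_source (I := I) b
  have hy0 := mem_extChartAt_target (I := I) b
  have hopen := isOpen_extChartAt_target (I := I) b
  have hg := isMetricOn_chartMetric I b
  have hconst : ∀ u : TangentSpace I b, ∀ y ∈ (extChartAt I b).target,
      chartField I b (FiberBundle.extend E u) y =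
        toChart I b u := by
    intro u y hy
    rw [chartField_extend I u hy, chartField_eq_toChart, FiberBundle.extend_apply_self]
  have hev : ∀ u : TangentSpace I b, ∀ y ∈ (extChartAt I b).target,
      chartField I b (FiberBundle.extend E u) =ᶠ[nhds y]
        fun _ ↦ toChart I b u := by
    intro u y hy
    filter_upwards [hopen.mem_nhds hy] with z hz using hconst u z hz
  have hdiff : ∀ X : Π x : M, TangentSpace I x, ∀ y ∈ (extChartAt I b).target,
      DifferentiableAt ℝ (chartField I b X) y → MDifferentiableAt I I.tangent
        (fun x ↦ (X x : TangentBundle I M)) ((extChartAt I b).symm y) := by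
    intro X y hy hX
    refine mdifferentiableAt_of_chartField I ((extChartAt I b).map_target hy) ?_
    rwa [(extChartAt I b).right_inv hy]
  have hext : ∀ u : TangentSpace I b, ∀ y ∈ (extChartAt I b).target,
      MDifferentiableAt I I.tangent
        (fun x ↦ (FiberBundle.extend E u x : TangentBundle I M)) ((extChartAt I b).symm y) :=
    fun u y hy ↦ hdiff _ y hy
      ((differentiableAt_const _).congr_of_eventuallyEq (hev u y hy))
  have hLC : ∀ v w : TangentSpace I b, chartField I b (leviCivita I (FiberBundle.extend E v)
      (FiberBundle.extend E w)) =ᶠ[nhds (extChartAt I b b)] covariantDerivAlong (chartMetric I b) id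
        (chartField I b (FiberBundle.extend E v)) (chartField I b (FiberBundle.extend E w)) := by
    intro v w
    filter_upwards [hopen.mem_nhds hy0] with z hz
    exact chartField_leviCivita I hz (hext v z hz) (hext w z hz)
  have hC2 : ∀ u : TangentSpace I b,
      ContDiffAt ℝ 2 (chartField I b (FiberBundle.extend E u)) (extChartAt I b b) := fun u ↦
    contDiffAt_const.congr_of_eventuallyEq (hev u _ hy0)
  have hLCd : ∀ v w : TangentSpace I b, DifferentiableAt ℝ (chartField I b
      (leviCivita I (FiberBundle.extend E v) (FiberBundle.extend E w))) (extChartAt I b b) := by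
    intro v w
    refine DifferentiableAt.congr_of_eventuallyEq ?_ (hLC v w)
    have hd := (hasFDerivAt_fderiv_apply (hC2 w) ((hC2 v).differentiableAt (by simp))).add
      (((hg.hasFDerivAt_christoffel hy0).clm_apply
        ((hC2 v).differentiableAt (by simp)).hasFDerivAt).clm_apply
          ((hC2 w).differentiableAt (by simp)).hasFDerivAt)
    refine (hd.congr_of_eventuallyEq (Filter.Eventually.of_forall fun z ↦ ?_)).differentiableAt
    simp [covariantDerivAlong]
  have hLC2 : ∀ u v w : TangentSpace I b, chartField I b (leviCivita I (FiberBundle.extend E u)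
      (leviCivita I (FiberBundle.extend E v) (FiberBundle.extend E w))) (extChartAt I b b) =
      covariantDerivAlong (chartMetric I b) id (chartField I b (FiberBundle.extend E u))
        (covariantDerivAlong (chartMetric I b) id (chartField I b (FiberBundle.extend E v))
          (chartField I b (FiberBundle.extend E w))) (extChartAt I b b) := by
    intro u v w
    rw [chartField_leviCivita I hy0 (hext u _ hy0) (hdiff _ _ hy0 (hLCd v w))]
    simp only [covariantDerivAlong, (hLC v w).fderiv_eq, (hLC v w).eq_of_nhds]
  have hbr : chartField I b (mlieBracket I (FiberBundle.extend E u) (FiberBundle.extend E v))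
      =ᶠ[nhds (extChartAt I b b)] lieBracket ℝ (chartField I b (FiberBundle.extend E u))
        (chartField I b (FiberBundle.extend E v)) := by
    filter_upwards [hopen.mem_nhds hy0] with z hz
    exact chartField_mlieBracket I hz (hext u z hz) (hext v z hz)
  have hbr0 : chartField I b (mlieBracket I (FiberBundle.extend E u) (FiberBundle.extend E v))
      =ᶠ[nhds (extChartAt I b b)] fun _ ↦ 0 := by
    filter_upwards [hopen.mem_nhds hy0] with z hz
    rw [chartField_mlieBracket I hz (hext u z hz) (hext v z hz), lieBracket,
      (hev u z hz).fderiv_eq, (hev v z hz).fderiv_eq]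
    simp
  have hLC3 : chartField I b (leviCivita I (mlieBracket I (FiberBundle.extend E u)
      (FiberBundle.extend E v)) (FiberBundle.extend E w)) (extChartAt I b b) =
      covariantDerivAlong (chartMetric I b) id (lieBracket ℝ
        (chartField I b (FiberBundle.extend E u)) (chartField I b (FiberBundle.extend E v)))
          (chartField I b (FiberBundle.extend E w)) (extChartAt I b b) := by
    rw [chartField_leviCivita I hy0 (hdiff _ _ hy0
      ((differentiableAt_const _).congr_of_eventuallyEq hbr0)) (hext w _ hy0)]
    simp only [covariantDerivAlong, hbr.eq_of_nhds]
  have hcomm := covariantDerivAlong_commutator hg (f := id) (q := extChartAt I b b) hy0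
    contDiffAt_id ((hC2 u).differentiableAt (by simp)) ((hC2 v).differentiableAt (by simp)) (hC2 w)
  rw [← hLC2, ← hLC2, ← hLC3, chartField_eq_toChart, chartField_eq_toChart,
    chartField_eq_toChart, hconst u _ hy0, hconst v _ hy0, hconst w _ hy0] at hcomm
  simp only [fderiv_id, id] at hcomm
  rw [curvature, map_sub, map_sub]
  exact hcomm

theorem inner_curvature {b : M} (u v w z : TangentSpace I b) :
    inner ℝ (curvature I u v w) z = chartMetric I b (extChartAt I b b)
      (localCurvature (chartMetric I b) (extChartAt I b b)
      (toChart I b u) (toChart I b v)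
      (toChart I b w)) (toChart I b z) := by
  rw [← toChart_curvature]
  exact (chartMetric_toChart I _ _).symm

theorem isCurvatureLike_curvature (b : M) :
    IsCurvatureLike fun u v w z : TangentSpace I b ↦ inner ℝ (curvature I u v w) z where
  isLinearMap v w z := by
    constructor
    · intro u u'
      simp only [inner_curvature, map_add, (isLinearMap_localCurvature _ _ _ _ _).map_add]
    · intro c u
      simp only [inner_curvature, map_smul, (isLinearMap_localCurvature _ _ _ _ _).map_smul]
  swap_left u v w z := by
    simp only [inner_curvature]
    rw [IsMetricOn.localCurvature_swap_left, map_neg, neg_apply]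
  swap_right u v w z := by
    simp only [inner_curvature]
    exact (isMetricOn_chartMetric I b).localCurvature_swap_right (mem_extChartAt_target b) ..
  pair_symm u v w z := by
    simp only [inner_curvature]
    exact (isMetricOn_chartMetric I b).localCurvature_pair_symm (mem_extChartAt_target b) ..

omit [I.Boundaryless] [IsContMDiffRiemannianBundle I ∞ E (fun x : M ↦ TangentSpace I x)] in
theorem h4_eq_weylInvariant (b : M) :
    h4 I b = IsCurvatureLike.weylInvariant
      (fun u v w z : TangentSpace I b ↦ inner ℝ (curvature I u v w) z)
      (stdOrthonormalBasis ℝ (TangentSpace I b)) := rfl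

end LeviCivita

section Calculus

open VectorField Module

variable {E F : Type*} [NormedAddCommGroup E] [NormedSpace ℝ E]
  [NormedAddCommGroup F] [NormedSpace ℝ F]

/-- If a metric has constant coefficients with respect to the frames `∂₂μ(a, e)` and `∂₁μ(e, a)`,
then the Lie bracket of the first frame is skew-symmetric. -/
theorem metric_lieBracket_add_eq_zero {g : E → E →L[ℝ] E →L[ℝ] ℝ} {μ : E × E → E} {e : E}
    (hg : DifferentiableAt ℝ g e) (hμ : ContDiffAt ℝ 2 μ (e, e))
    (hl : ∀ u v, ∃ c, ∀ᶠ a in nhds e,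
      g a (fderiv ℝ μ (a, e) (0, u)) (fderiv ℝ μ (a, e) (0, v)) = c)
    (hr : ∀ u v, ∃ c, ∀ᶠ a in nhds e,
      g a (fderiv ℝ μ (e, a) (u, 0)) (fderiv ℝ μ (e, a) (v, 0)) = c)
    (hl1 : ∀ u, fderiv ℝ μ (e, e) (0, u) = u) (hr1 : ∀ u, fderiv ℝ μ (e, e) (u, 0) = u)
    (u v w : E) :
    g e (lieBracket ℝ (fun a ↦ fderiv ℝ μ (a, e) (0, u)) (fun a ↦ fderiv ℝ μ (a, e) (0, v)) e) w +
      g e v (lieBracket ℝ (fun a ↦ fderiv ℝ μ (a, e) (0, u))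
        (fun a ↦ fderiv ℝ μ (a, e) (0, w)) e) = 0 := by
  have hμ' := ((hμ.fderiv_right (m := 1) (by norm_num)).differentiableAt (by simp)).hasFDerivAt
  have hL : ∀ u, HasFDerivAt (fun a ↦ fderiv ℝ μ (a, e) (0, u))
      (((fderiv ℝ (fderiv ℝ μ) (e, e)) ∘L ContinuousLinearMap.inl ℝ E E).flip (0, u)) e := by
    intro u
    have h := (HasFDerivAt.comp (f := fun a ↦ (a, e)) e hμ'
      (hasFDerivAt_prodMk_left e e)).clm_apply (hasFDerivAt_const (0, u) e)
    simpa using h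
  have hR : ∀ u, HasFDerivAt (fun a ↦ fderiv ℝ μ (e, a) (u, 0))
      (((fderiv ℝ (fderiv ℝ μ) (e, e)) ∘L ContinuousLinearMap.inr ℝ E E).flip (u, 0)) e := by
    intro u
    have h := (HasFDerivAt.comp (f := fun a ↦ (e, a)) e hμ'
      (hasFDerivAt_prodMk_right e e)).clm_apply (hasFDerivAt_const (u, 0) e)
    simpa using h
  have hdiff : ∀ {V W : E → E} {V' W' : E →L[ℝ] E}, HasFDerivAt V V' e → HasFDerivAt W W' e →
      (∃ c, ∀ᶠ a in nhds e, g a (V a) (W a) = c) →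
      fderiv ℝ g e u (V e) (W e) + g e (V' u) (W e) + g e (V e) (W' u) = 0 := by
    intro V W V' W' hV hW ⟨c, hc⟩
    have h1 := (hg.hasFDerivAt.clm_apply hV).clm_apply hW
    have h2 : HasFDerivAt (fun a ↦ g a (V a) (W a)) (0 : E →L[ℝ] ℝ) e :=
      (hasFDerivAt_const c e).congr_of_eventuallyEq hc
    have h3 := DFunLike.congr_fun (h1.unique h2) u
    simp at h3
    linarith
  have h1 := hdiff (hL v) (hL w) (hl v w)
  have h2 := hdiff (hR v) (hR w) (hr v w)
  have hsymm := hμ.isSymmSndFDerivAt (by simp)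
  have h3 : ∀ v, lieBracket ℝ (fun a ↦ fderiv ℝ μ (a, e) (0, u))
      (fun a ↦ fderiv ℝ μ (a, e) (0, v)) e = fderiv ℝ (fderiv ℝ μ) (e, e) (u, 0) (0, v) -
        fderiv ℝ (fderiv ℝ μ) (e, e) (0, u) (v, 0) := by
    intro v
    rw [lieBracket, (hL u).fderiv, (hL v).fderiv, hl1, hl1]
    simp [hsymm (0, u) (v, 0)]
  simp only [hl1, hr1] at h1 h2
  simp only [h3, map_sub, sub_apply]
  simp at h1 h2
  linarith

/-- A function that is constant on the fibres of a submersion has a derivative that vanishes on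
the vertical vectors. -/
theorem fderiv_apply_eq_zero_of_eventually [CompleteSpace E] [FiniteDimensional ℝ F]
    {F' : Type*} [NormedAddCommGroup F'] [NormedSpace ℝ F'] [CompleteSpace F']
    {f : E → F} {k : E → F'} {x : E} (hf : ContDiffAt ℝ 1 f x) (hk : ContDiffAt ℝ 1 k x)
    (hsurj : Function.Surjective (fderiv ℝ f x)) (h : ∀ᶠ y in nhds x, f y = f x → k y = k x)
    {v : E} (hv : fderiv ℝ f x v = 0) : fderiv ℝ k x v = 0 := by
  have : CompleteSpace F := FiniteDimensional.complete ℝ F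
  refine SeparatingDual.eq_zero_of_forall_dual_eq_zero (R := ℝ) fun l ↦ ?_
  have hk' := hk.hasStrictFDerivAt one_ne_zero
  have hl : HasStrictFDerivAt (fun y ↦ l (k y)) (l ∘L fderiv ℝ k x) x :=
    l.hasStrictFDerivAt.comp x hk'
  have hext : IsLocalExtrOn (fun y ↦ l (k y)) {y | f y = f x} x := by
    left
    have : ∀ᶠ y in nhdsWithin x {y | f y = f x}, l (k x) ≤ l (k y) := by
      filter_upwards [nhdsWithin_le_nhds h, self_mem_nhdsWithin] with y h1 h2
      rw [h1 h2]
    exact this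
  obtain ⟨Λ, Λ₀, h0, h1⟩ := hext.exists_linear_map_of_hasStrictFDerivAt
    (hf.hasStrictFDerivAt one_ne_zero) hl
  have hΛ₀ : Λ₀ ≠ 0 := by
    rintro rfl
    refine h0 (Prod.ext (LinearMap.ext fun u ↦ ?_) rfl)
    obtain ⟨z, rfl⟩ := hsurj u
    simpa using h1 z
  have h2 := h1 v
  rw [hv] at h2
  simpa [hΛ₀] using h2

end Calculus

section Chart

variable {E : Type*} [NormedAddCommGroup E] [NormedSpace ℝ E]
  {H : Type*} [TopologicalSpace H] (I : ModelWithCorners ℝ E H) [I.Boundaryless]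
  {M : Type*} [TopologicalSpace M] [ChartedSpace H M] [IsManifold I ∞ M]
  {E' : Type*} [NormedAddCommGroup E'] [NormedSpace ℝ E']
  {H' : Type*} [TopologicalSpace H'] (I' : ModelWithCorners ℝ E' H')
  {M' : Type*} [TopologicalSpace M'] [ChartedSpace H' M'] [IsManifold I' ∞ M']

theorem contDiffAt_inCharts {f : M → M'} {b x : M} {b' : M'} {n : WithTop ℕ∞} (hn : n ≤ ∞)
    (hx : x ∈ (extChartAt I b).source) (hfx : f x ∈ (extChartAt I' b').source)
    (hf : ContMDiffAt I I' n f x) :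
    ContDiffAt ℝ n (extChartAt I' b' ∘ f ∘ (extChartAt I b).symm) (extChartAt I b x) := by
  have h1 := (contMDiffAt_extChartAt_symm I ((extChartAt I b).map_source hx)).of_le hn
  have h2 := (contMDiffAt_extChartAt' (I := I') (n := ∞) (x := b') (x' := f x)
    (by simpa using hfx)).of_le hn
  have h3 := h2.comp x hf
  exact (h3.comp_of_eq h1 ((extChartAt I b).left_inv hx)).contDiffAt

theorem fderiv_inCharts {f : M → M'} {b x : M} {b' : M'}
    (hx : x ∈ (extChartAt I b).source) (hfx : f x ∈ (extChartAt I' b').source)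
    (hf : ContMDiffAt I I' 1 f x) (v : TangentSpace I x) :
    fderiv ℝ (extChartAt I' b' ∘ f ∘ (extChartAt I b).symm) (extChartAt I b x)
      (mfderiv I 𝓘(ℝ, E) (extChartAt I b) x v) =
      mfderiv I' 𝓘(ℝ, E') (extChartAt I' b') (f x) (mfderiv I I' f x v) := by
  have h0 := (contDiffAt_inCharts I I' ENat.LEInfty.out hx hfx hf).differentiableAt
    one_ne_zero |>.mdifferentiableAt
  have h1 := (contMDiffAt_extChartAt' (I := I) (n := 1) (x := b) (x' := x)
    (by simpa using hx)).mdifferentiableAt one_ne_zero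
  have h2 := (contMDiffAt_extChartAt' (I := I') (n := 1) (x := b') (x' := f x)
    (by simpa using hfx)).mdifferentiableAt one_ne_zero
  have h3 := mfderiv_comp x h0 h1
  have h4 := mfderiv_comp x h2 (hf.mdifferentiableAt one_ne_zero)
  have h5 : (extChartAt I' b' ∘ f ∘ (extChartAt I b).symm) ∘ extChartAt I b =ᶠ[nhds x]
      extChartAt I' b' ∘ f := by
    filter_upwards [(isOpen_extChartAt_source b).mem_nhds hx] with z hz
    exact congrArg (fun z ↦ extChartAt I' b' (f z)) ((extChartAt I b).left_inv hz)
  rw [h5.mfderiv_eq, h4, mfderiv_eq_fderiv] at h3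
  exact (DFunLike.congr_fun h3 v).symm

end Chart

section LieGroup

open VectorField

variable {E : Type*} [NormedAddCommGroup E] [NormedSpace ℝ E]
  {H : Type*} [TopologicalSpace H] (I : ModelWithCorners ℝ E H) [I.Boundaryless]
  {G : Type*} [TopologicalSpace G] [ChartedSpace H G] [Group G] [LieGroup I ∞ G]

/-- The multiplication in the chart at the identity. -/
def chartMul (G : Type*) [TopologicalSpace G] [ChartedSpace H G] [Group G] (p : E × E) : E :=
  extChartAt I (1 : G) ((extChartAt I (1 : G)).symm p.1 * (extChartAt I (1 : G)).symm p.2)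

theorem contDiffAt_chartMul {p : E × E} (h1 : p.1 ∈ (extChartAt I (1 : G)).target)
    (h2 : p.2 ∈ (extChartAt I (1 : G)).target)
    (h : (extChartAt I (1 : G)).symm p.1 * (extChartAt I (1 : G)).symm p.2 ∈
      (extChartAt I (1 : G)).source) : ContDiffAt ℝ ∞ (chartMul I G) p := by
  have h3 : ContMDiffAt 𝓘(ℝ, E × E) I ∞
      (fun p : E × E ↦ (extChartAt I (1 : G)).symm p.1 * (extChartAt I (1 : G)).symm p.2) p :=
    ContMDiffAt.mul
      ((contMDiffAt_extChartAt_symm I h1).comp p contDiffAt_fst.contMDiffAt)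
      ((contMDiffAt_extChartAt_symm I h2).comp p contDiffAt_snd.contMDiffAt)
  have h4 := contMDiffAt_extChartAt' (I := I) (n := ∞) (x := (1 : G)) (by simpa using h)
  exact (h4.comp p h3).contDiffAt

theorem fderiv_chartMul_left {a : E} (ha : a ∈ (extChartAt I (1 : G)).target)
    (x : TangentSpace I (1 : G)) :
    fderiv ℝ (chartMul I G) (a, extChartAt I (1 : G) 1) (0, toChart I 1 x) =
      mfderiv I 𝓘(ℝ, E) (extChartAt I (1 : G)) ((extChartAt I (1 : G)).symm a * 1)
        (mfderiv I I ((extChartAt I (1 : G)).symm a * ·) 1 x) := by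
  have hs : (extChartAt I (1 : G)).symm a * 1 ∈ (extChartAt I (1 : G)).source := by
    rw [mul_one]; exact (extChartAt I (1 : G)).map_target ha
  have h1 := fderiv_inCharts I I (f := fun z ↦ (extChartAt I (1 : G)).symm a * z)
    (b := 1) (b' := 1) (mem_extChartAt_source 1) hs
    (contMDiff_mul_left (n := ∞) |>.contMDiffAt.of_le ENat.LEInfty.out) x
  rw [← h1]
  have h2 := ((contDiffAt_chartMul I (G := G) (p := (a, extChartAt I (1 : G) 1)) ha
    (mem_extChartAt_target 1) (by
      rw [(extChartAt I (1 : G)).left_inv (mem_extChartAt_source 1)]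
      exact hs)).differentiableAt (by simp)).hasFDerivAt
  have h3 := HasFDerivAt.comp (f := fun y ↦ (a, y)) (extChartAt I (1 : G) 1) h2
    (hasFDerivAt_prodMk_right a _)
  exact (DFunLike.congr_fun h3.fderiv (toChart I 1 x)).symm

theorem fderiv_chartMul_right {a : E} (ha : a ∈ (extChartAt I (1 : G)).target)
    (x : TangentSpace I (1 : G)) :
    fderiv ℝ (chartMul I G) (extChartAt I (1 : G) 1, a) (toChart I 1 x, 0) =
      mfderiv I 𝓘(ℝ, E) (extChartAt I (1 : G)) (1 * (extChartAt I (1 : G)).symm a)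
        (mfderiv I I (· * (extChartAt I (1 : G)).symm a) 1 x) := by
  have hs : 1 * (extChartAt I (1 : G)).symm a ∈ (extChartAt I (1 : G)).source := by
    rw [one_mul]; exact (extChartAt I (1 : G)).map_target ha
  have h1 := fderiv_inCharts I I (f := fun z ↦ z * (extChartAt I (1 : G)).symm a)
    (b := 1) (b' := 1) (mem_extChartAt_source 1) hs
    (contMDiff_mul_right (n := ∞) |>.contMDiffAt.of_le ENat.LEInfty.out) x
  rw [← h1]
  have h2 := ((contDiffAt_chartMul I (G := G) (p := (extChartAt I (1 : G) 1, a))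
    (mem_extChartAt_target 1) ha (by
      rw [(extChartAt I (1 : G)).left_inv (mem_extChartAt_source 1)]
      exact hs)).differentiableAt (by simp)).hasFDerivAt
  have h3 := HasFDerivAt.comp (f := fun y ↦ (y, a)) (extChartAt I (1 : G) 1) h2
    (hasFDerivAt_prodMk_left _ a)
  exact (DFunLike.congr_fun h3.fderiv (toChart I 1 x)).symm

omit [I.Boundaryless] [Group G] [LieGroup I ∞ G] in
theorem mfderiv_congr_base {F : Type*} [NormedAddCommGroup F] [NormedSpace ℝ F] (f : G → F)
    {p q : G} (h : p = q) (w : E) :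
    (mfderiv I 𝓘(ℝ, F) f p w : F) = mfderiv I 𝓘(ℝ, F) f q w := by
  subst h; rfl

omit [I.Boundaryless] [Group G] [LieGroup I ∞ G] in
theorem mfderiv_eq_self {f : G → G} (hf : f = id) (p : G) (w : E) :
    (mfderiv I I f p w : E) = w := by
  subst hf; rw [mfderiv_id]; rfl

theorem chartField_mulInvariantVectorField {a : E} (ha : a ∈ (extChartAt I (1 : G)).target)
    (x : GroupLieAlgebra I G) :
    chartField I 1 (mulInvariantVectorField x) a =
      fderiv ℝ (chartMul I G) (a, extChartAt I (1 : G) 1) (0, toChart I 1 x) := by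
  rw [fderiv_chartMul_left I ha]
  have h := chartField_extChartAt I (mulInvariantVectorField x)
    ((extChartAt I (1 : G)).map_target ha)
  rw [(extChartAt I (1 : G)).right_inv ha] at h
  rw [h]
  exact mfderiv_congr_base I _ (mul_one _).symm _

variable [FiniteDimensional ℝ E] [RiemannianBundle (fun x : G ↦ TangentSpace I x)]
    [IsContMDiffRiemannianBundle I ∞ E (fun x : G ↦ TangentSpace I x)]

variable (G) in
omit [I.Boundaryless] [RiemannianBundle (fun x : G ↦ TangentSpace I x)]
    [IsContMDiffRiemannianBundle I ∞ E (fun x : G ↦ TangentSpace I x)] in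
/-- The bracket of the Lie algebra of a Lie group, as a bilinear map. -/
def groupBracket : TangentSpace I (1 : G) →ₗ[ℝ] TangentSpace I (1 : G) →ₗ[ℝ]
    TangentSpace I (1 : G) :=
  haveI : CompleteSpace E := FiniteDimensional.complete ℝ E
  haveI : LieGroup I (minSmoothness ℝ 3) G := lieGroup_minSmoothness I G
  LinearMap.mk₂ ℝ (fun x y : GroupLieAlgebra I G ↦ ⁅x, y⁆) add_lie smul_lie lie_add lie_smul

omit [I.Boundaryless] [RiemannianBundle (fun x : G ↦ TangentSpace I x)]
    [IsContMDiffRiemannianBundle I ∞ E (fun x : G ↦ TangentSpace I x)] in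
theorem groupBracket_apply (x y : TangentSpace I (1 : G)) :
    groupBracket I G x y = mlieBracket I (mulInvariantVectorField x) (mulInvariantVectorField y)
      (1 : G) := rfl

theorem IsBiinvariant.inner_groupBracket (hG : IsBiinvariant I G) (x y z : TangentSpace I (1 : G)) :
    inner ℝ (groupBracket I G x y) z = -inner ℝ y (groupBracket I G x z) := by
  have : CompleteSpace E := FiniteDimensional.complete ℝ E
  have : LieGroup I (minSmoothness ℝ 3) G := lieGroup_minSmoothness I G
  have hsymm1 := (extChartAt I (1 : G)).left_inv (mem_extChartAt_source 1)
  have htarget := (isOpen_extChartAt_target (I := I) (1 : G)).mem_nhds (mem_extChartAt_target 1)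
  have hsurj : Function.Surjective (toChart I (1 : G)) :=
    (isInvertible_mfderiv_extChartAt (I := I) (mem_extChartAt_source (1 : G))).surjective
  have h := metric_lieBracket_add_eq_zero (g := chartMetric I (1 : G)) (μ := chartMul I G)
    (e := extChartAt I (1 : G) 1)
    ((isMetricOn_chartMetric I (1 : G)).differentiableAt (mem_extChartAt_target 1))
    ((contDiffAt_chartMul I (mem_extChartAt_target 1) (mem_extChartAt_target 1)
      (by simp only [hsymm1, mul_one]; exact mem_extChartAt_source 1)).of_le ENat.LEInfty.out)
    (fun u v ↦ by
      obtain ⟨x, rfl⟩ := hsurj u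
      obtain ⟨y, rfl⟩ := hsurj v
      refine ⟨inner ℝ x y, ?_⟩
      filter_upwards [htarget] with a ha
      rw [fderiv_chartMul_left I ha, fderiv_chartMul_left I ha]
      have hs : (extChartAt I (1 : G)).symm a * 1 ∈ (extChartAt I (1 : G)).source := by
        rw [mul_one]; exact (extChartAt I (1 : G)).map_target ha
      have h1 := chartMetric_mfderiv I hs (mfderiv I I ((extChartAt I (1 : G)).symm a * ·) 1 x)
        (mfderiv I I ((extChartAt I (1 : G)).symm a * ·) 1 y)
      rw [hG.1] at h1
      have h2 : extChartAt I (1 : G) ((extChartAt I (1 : G)).symm a * 1) = a := by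
        rw [mul_one]; exact (extChartAt I (1 : G)).right_inv ha
      rw [h2] at h1
      exact h1)
    (fun u v ↦ by
      obtain ⟨x, rfl⟩ := hsurj u
      obtain ⟨y, rfl⟩ := hsurj v
      refine ⟨inner ℝ x y, ?_⟩
      filter_upwards [htarget] with a ha
      rw [fderiv_chartMul_right I ha, fderiv_chartMul_right I ha]
      have hs : 1 * (extChartAt I (1 : G)).symm a ∈ (extChartAt I (1 : G)).source := by
        rw [one_mul]; exact (extChartAt I (1 : G)).map_target ha
      have h1 := chartMetric_mfderiv I hs (mfderiv I I (· * (extChartAt I (1 : G)).symm a) 1 x)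
        (mfderiv I I (· * (extChartAt I (1 : G)).symm a) 1 y)
      rw [hG.2] at h1
      have h2 : extChartAt I (1 : G) (1 * (extChartAt I (1 : G)).symm a) = a := by
        rw [one_mul]; exact (extChartAt I (1 : G)).right_inv ha
      rw [h2] at h1
      exact h1)
    (fun u ↦ by
      obtain ⟨x, rfl⟩ := hsurj u
      rw [← chartField_mulInvariantVectorField I (mem_extChartAt_target 1), chartField_eq_toChart]
      exact congrArg (toChart I (1 : G)) (mfderiv_eq_self I (funext one_mul) _ _))
    (fun u ↦ by
      obtain ⟨x, rfl⟩ := hsurj u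
      rw [fderiv_chartMul_right I (mem_extChartAt_target 1), hsymm1]
      exact (mfderiv_congr_base I _ (one_mul _) _).trans
        (congrArg (toChart I (1 : G)) (mfderiv_eq_self I (funext mul_one) _ _)))
    (toChart I 1 x) (toChart I 1 y) (toChart I 1 z)
  have hbr : ∀ x y : TangentSpace I (1 : G),
      lieBracket ℝ (fun a ↦ fderiv ℝ (chartMul I G) (a, extChartAt I (1 : G) 1) (0, toChart I 1 x))
      (fun a ↦ fderiv ℝ (chartMul I G) (a, extChartAt I (1 : G) 1) (0, toChart I 1 y))
      (extChartAt I (1 : G) 1) = toChart I 1 (groupBracket I G x y) := by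
    intro x y
    have hev : ∀ x : GroupLieAlgebra I G, (fun a ↦ fderiv ℝ (chartMul I G)
        (a, extChartAt I (1 : G) 1) (0, toChart I 1 x)) =ᶠ[nhds (extChartAt I (1 : G) 1)]
          chartField I 1 (mulInvariantVectorField x) := by
      intro x
      filter_upwards [htarget] with a ha using (chartField_mulInvariantVectorField I ha x).symm
    rw [(hev x).lieBracket_vectorField_eq (hev y), groupBracket_apply,
      ← chartField_eq_toChart]
    exact (chartField_mlieBracket I (mem_extChartAt_target 1)
      (mdifferentiableAt_mulInvariantVectorField x)
      (mdifferentiableAt_mulInvariantVectorField y)).symm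
  rw [hbr, hbr, chartMetric_toChart, chartMetric_toChart] at h
  linarith

end LieGroup

section Submersion

open VectorField

variable {E : Type*} [NormedAddCommGroup E] [NormedSpace ℝ E] [FiniteDimensional ℝ E]
  {H : Type*} [TopologicalSpace H] (I : ModelWithCorners ℝ E H) [I.Boundaryless]
  {G : Type*} [TopologicalSpace G] [ChartedSpace H G] [Group G] [LieGroup I ∞ G]
  {E' : Type*} [NormedAddCommGroup E'] [NormedSpace ℝ E'] [FiniteDimensional ℝ E']
  {H' : Type*} [TopologicalSpace H'] (I' : ModelWithCorners ℝ E' H') [I'.Boundaryless]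
  {B : Type*} [TopologicalSpace B] [ChartedSpace H' B] [IsManifold I' ∞ B]
  {f : G → B}

variable (f) in
/-- The image under the differential of `f` at `a` of the left-invariant vector fields. -/
def invariantImage (a : G) : TangentSpace I (1 : G) →L[ℝ] TangentSpace I' (f a) :=
  (mfderiv I I' f a).comp
    (mfderiv I I (a * ·) (1 : G) : TangentSpace I (1 : G) →L[ℝ] TangentSpace I a)

omit [FiniteDimensional ℝ E] [I.Boundaryless] [FiniteDimensional ℝ E'] [I'.Boundaryless]
  [LieGroup I ∞ G] [IsManifold I' ∞ B] in
theorem invariantImage_apply (a : G) (x : TangentSpace I (1 : G)) :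
    invariantImage I I' f a x = mfderiv I I' f a (mulInvariantVectorField x a) := rfl

omit [I'.Boundaryless] in
theorem invariantImage_eq_zero_of_fibres (hf : ContMDiff I I' ∞ f)
    (hsurj : Function.Surjective (mfderiv I I' f 1))
    (hfib : ∀ a x, f x = f 1 → f (a * x) = f a) (a : G) {v : TangentSpace I (1 : G)}
    (hv : mfderiv I I' f 1 v = 0) : invariantImage I I' f a v = 0 := by
  have : CompleteSpace E := FiniteDimensional.complete ℝ E
  have : CompleteSpace E' := FiniteDimensional.complete ℝ E'
  let k : G → B := f ∘ fun x ↦ a * x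
  have hk : ContMDiff I I' ∞ k := hf.comp contMDiff_mul_left
  have hle : (1 : WithTop ℕ∞) ≤ ∞ := ENat.LEInfty.out
  have h1 := mem_extChartAt_source (I := I) (1 : G)
  have hf' := fderiv_inCharts I I' h1 (mem_extChartAt_source (f 1)) (hf.contMDiffAt.of_le hle)
  have hk' := fderiv_inCharts I I' h1 (mem_extChartAt_source (k 1)) (hk.contMDiffAt.of_le hle)
  have hψ := isInvertible_mfderiv_extChartAt (I := I') (mem_extChartAt_source (f 1))
  have hψk := isInvertible_mfderiv_extChartAt (I := I') (mem_extChartAt_source (k 1))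
  have key : fderiv ℝ (extChartAt I' (k 1) ∘ k ∘ (extChartAt I (1 : G)).symm)
      (extChartAt I (1 : G) 1) (toChart I 1 v) = 0 := by
    refine fderiv_apply_eq_zero_of_eventually
      (f := extChartAt I' (f 1) ∘ f ∘ (extChartAt I (1 : G)).symm)
      (contDiffAt_inCharts I I' hle h1 (mem_extChartAt_source (f 1)) (hf.contMDiffAt.of_le hle))
      (contDiffAt_inCharts I I' hle h1 (mem_extChartAt_source (k 1)) (hk.contMDiffAt.of_le hle))
      ?_ ?_ ?_
    · intro w
      obtain ⟨w', hw'⟩ := hψ.surjective w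
      obtain ⟨w'', rfl⟩ := hsurj w'
      exact ⟨_, (hf' w'').trans hw'⟩
    · have hc : ContinuousAt (f ∘ (extChartAt I (1 : G)).symm) (extChartAt I (1 : G) 1) :=
        hf.continuous.continuousAt.comp (continuousAt_extChartAt_symm 1)
      have hs : (extChartAt I' (f 1)).source ∈
          nhds ((f ∘ (extChartAt I (1 : G)).symm) (extChartAt I (1 : G) 1)) := by
        simp only [Function.comp_apply, (extChartAt I (1 : G)).left_inv h1]
        exact extChartAt_source_mem_nhds _
      filter_upwards [hc hs] with y hy hfy
      simp only [Function.comp_apply, (extChartAt I (1 : G)).left_inv h1] at hfy ⊢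
      have h2 := (extChartAt I' (f 1)).injOn hy (mem_extChartAt_source (f 1)) hfy
      rw [show k ((extChartAt I (1 : G)).symm y) = k 1 from
        (hfib a _ h2).trans (congrArg f (mul_one a).symm)]
    · exact (hf' v).trans ((congrArg _ hv).trans (map_zero _))
  have h2 : mfderiv I I' k 1 v = 0 :=
    hψk.injective (((hk' v).symm.trans key).trans (map_zero _).symm)
  have h3 := mfderiv_comp (1 : G) (hf.mdifferentiable (by simp) (a * 1))
    ((contMDiff_mul_left (I := I) (n := ∞) (a := a)).mdifferentiable (by simp) 1)
  have h4 : ∀ q q' : G, q = q' → ∀ w : E,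
      (mfderiv I I' f q w : E') = mfderiv I I' f q' w := by rintro q _ rfl w; rfl
  exact (h4 a (a * 1) (mul_one a).symm _).trans ((DFunLike.congr_fun h3 v).symm.trans h2)

variable [RiemannianBundle (fun x : G ↦ TangentSpace I x)]
  [RiemannianBundle (fun x : B ↦ TangentSpace I' x)]

omit [FiniteDimensional ℝ E] [I.Boundaryless] [LieGroup I ∞ G] in
theorem IsBiinvariant.inner_mulInvariantVectorField (hG : IsBiinvariant I G) (a : G)
    (x y : TangentSpace I (1 : G)) :
    inner ℝ (mulInvariantVectorField x a) (mulInvariantVectorField y a) = inner ℝ x y := by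
  have h : ∀ q q' : G, q = q' → ∀ v w : E,
      @inner ℝ (TangentSpace I q) _ v w = @inner ℝ (TangentSpace I q') _ v w := by
    rintro q _ rfl v w; rfl
  exact (h a (a * 1) (mul_one a).symm _ _).trans (hG.1 a 1 x y)

omit [I.Boundaryless] [LieGroup I ∞ G] in
theorem IsBiinvariant.exists_mulInvariantVectorField_eq (hG : IsBiinvariant I G) (a : G)
    (w : TangentSpace I a) : ∃ x : TangentSpace I (1 : G), mulInvariantVectorField x a = w := by
  let T : TangentSpace I (1 : G) →ₗ[ℝ] TangentSpace I (a * 1) :=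
    (mfderiv I I (a * ·) (1 : G)).toLinearMap
  have hT : Function.Injective T := by
    rw [← LinearMap.ker_eq_bot, LinearMap.ker_eq_bot']
    intro x hx
    have h := hG.inner_mulInvariantVectorField I a x x
    have h1 : mulInvariantVectorField (I := I) x a = 0 := hx
    rw [h1, inner_zero_left] at h
    exact inner_self_eq_zero.1 h.symm
  exact (LinearMap.injective_iff_surjective_of_finrank_eq_finrank rfl).1 hT w

/-- `f` is a Riemannian submersion of a Lie group with a bi-invariant metric, and `f` maps left
cosets of the fibre of the identity to points. -/
structure IsNormalSubmersion (f : G → B) : Prop where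
  biinvariant : IsBiinvariant I G
  submersion : IsRiemannianSubmersion I I' f
  fibres : ∀ a x, f x = f 1 → f (a * x) = f a

namespace IsNormalSubmersion

variable {I I'} (hf : IsNormalSubmersion I I' f)
include hf

omit [I.Boundaryless] [LieGroup I ∞ G] [FiniteDimensional ℝ E'] [I'.Boundaryless]
  [IsManifold I' ∞ B] in
theorem surjective (a : G) : Function.Surjective (invariantImage I I' f a) := by
  intro u
  obtain ⟨w, rfl⟩ := hf.submersion.2.1 a u
  obtain ⟨x, rfl⟩ := hf.biinvariant.exists_mulInvariantVectorField_eq I a w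
  exact ⟨x, rfl⟩

omit [I'.Boundaryless] in
theorem eq_zero_iff (a : G) (x : TangentSpace I (1 : G)) :
    invariantImage I I' f a x = 0 ↔ mfderiv I I' f 1 x = 0 := by
  let S : TangentSpace I (1 : G) →ₗ[ℝ] TangentSpace I' (f 1) := (mfderiv I I' f 1).toLinearMap
  let T : TangentSpace I (1 : G) →ₗ[ℝ] TangentSpace I' (f a) :=
    (invariantImage I I' f a).toLinearMap
  have hle : LinearMap.ker S ≤ LinearMap.ker T := fun v hv ↦
    invariantImage_eq_zero_of_fibres I I' hf.submersion.1 (hf.submersion.2.1 1) hf.fibres a hv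
  have h1 := LinearMap.finrank_range_add_finrank_ker S
  have h2 := LinearMap.finrank_range_add_finrank_ker T
  rw [LinearMap.range_eq_top.2 (hf.submersion.2.1 1), finrank_top] at h1
  rw [LinearMap.range_eq_top.2 (hf.surjective a), finrank_top] at h2
  have h3 : Module.finrank ℝ (TangentSpace I' (f 1)) = Module.finrank ℝ (TangentSpace I' (f a)) :=
    rfl
  have h4 := Submodule.eq_of_le_of_finrank_eq hle (by omega)
  exact (SetLike.ext_iff.1 h4 x).symm

omit [I'.Boundaryless] in
theorem isHorizontal {x : TangentSpace I (1 : G)} (hx : IsHorizontal I I' f x) (a : G) :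
    IsHorizontal I I' f (mulInvariantVectorField (I := I) x a) := by
  intro w hw
  obtain ⟨w, rfl⟩ := hf.biinvariant.exists_mulInvariantVectorField_eq I a w
  rw [hf.biinvariant.inner_mulInvariantVectorField]
  exact hx w ((hf.eq_zero_iff a w).1 hw)

omit [I.Boundaryless] [LieGroup I ∞ G] [FiniteDimensional ℝ E'] [I'.Boundaryless]
  [IsManifold I' ∞ B] hf in
variable (I I' f) in
theorem exists_horizontal (x : TangentSpace I (1 : G)) : ∃ y : TangentSpace I (1 : G),
    IsHorizontal I I' f y ∧ mfderiv I I' f 1 (x - y) = 0 := by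
  obtain ⟨p, hp, q, hq, rfl⟩ := Submodule.exists_add_mem_mem_orthogonal
    (K := LinearMap.ker (mfderiv I I' f 1).toLinearMap) x
  refine ⟨q, fun w hw ↦ (Submodule.mem_orthogonal' _ _).1 hq w hw, ?_⟩
  rw [add_sub_cancel_right]
  exact hp

omit [I'.Boundaryless] in
theorem exists_lift (a : G) (u : TangentSpace I' (f a)) : ∃ x : TangentSpace I (1 : G),
    IsHorizontal I I' f x ∧ invariantImage I I' f a x = u := by
  obtain ⟨x, rfl⟩ := hf.surjective a u
  obtain ⟨y, hy, h⟩ := exists_horizontal I I' f x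
  refine ⟨y, hy, ?_⟩
  have := (hf.eq_zero_iff a (x - y)).2 h
  rw [map_sub, sub_eq_zero] at this
  exact this.symm

omit [I'.Boundaryless] in
theorem inner_invariantImage_of_horizontal {x : TangentSpace I (1 : G)}
    (hx : IsHorizontal I I' f x) (a : G) (w : TangentSpace I (1 : G)) :
    inner ℝ (invariantImage I I' f a x) (invariantImage I I' f a w) = inner ℝ x w := by
  obtain ⟨y, hy, h⟩ := exists_horizontal I I' f w
  have h1 := (hf.eq_zero_iff a (w - y)).2 h
  rw [map_sub, sub_eq_zero] at h1
  have h2 := hx (w - y) h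
  rw [inner_sub_right, sub_eq_zero] at h2
  rw [h1, h2, invariantImage_apply, invariantImage_apply,
    hf.submersion.2.2 a _ _ (hf.isHorizontal hx a) (hf.isHorizontal hy a),
    hf.biinvariant.inner_mulInvariantVectorField]

omit [I'.Boundaryless] in
theorem inner_invariantImage (a : G) (x y : TangentSpace I (1 : G)) :
    inner ℝ (invariantImage I I' f a x) (invariantImage I I' f a y) =
      inner ℝ (invariantImage I I' f 1 x) (invariantImage I I' f 1 y) := by
  obtain ⟨x', hx', h⟩ := exists_horizontal I I' f x
  have h1 := fun a ↦ (hf.eq_zero_iff a (x - x')).2 h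
  simp only [map_sub, sub_eq_zero] at h1
  rw [h1, h1, hf.inner_invariantImage_of_horizontal hx', hf.inner_invariantImage_of_horizontal hx']

variable [IsContMDiffRiemannianBundle I ∞ E (fun x : G ↦ TangentSpace I x)]
  [IsContMDiffRiemannianBundle I' ∞ E' (fun x : B ↦ TangentSpace I' x)]

end IsNormalSubmersion

end Submersion

section Submersion

open VectorField

variable {E : Type*} [NormedAddCommGroup E] [NormedSpace ℝ E] [FiniteDimensional ℝ E]
  {H : Type*} [TopologicalSpace H] {I : ModelWithCorners ℝ E H} [I.Boundaryless]
  {G : Type*} [TopologicalSpace G] [ChartedSpace H G] [Group G] [LieGroup I ∞ G]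
  {E' : Type*} [NormedAddCommGroup E'] [NormedSpace ℝ E'] [FiniteDimensional ℝ E']
  {H' : Type*} [TopologicalSpace H'] {I' : ModelWithCorners ℝ E' H'} [I'.Boundaryless]
  {B : Type*} [TopologicalSpace B] [ChartedSpace H' B] [IsManifold I' ∞ B]
  {f : G → B}
  [RiemannianBundle (fun x : G ↦ TangentSpace I x)]
  [IsContMDiffRiemannianBundle I ∞ E (fun x : G ↦ TangentSpace I x)]
  [RiemannianBundle (fun x : B ↦ TangentSpace I' x)]

theorem IsBiinvariant.isInvariantBracket (hG : IsBiinvariant I G) :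
    IsInvariantBracket (groupBracket I G) where
  skew x y := by
    have : CompleteSpace E := FiniteDimensional.complete ℝ E
    have : LieGroup I (minSmoothness ℝ 3) G := lieGroup_minSmoothness I G
    exact (lie_skew (x : GroupLieAlgebra I G) (y : GroupLieAlgebra I G)).symm
  leibniz x y z := by
    have : CompleteSpace E := FiniteDimensional.complete ℝ E
    have : LieGroup I (minSmoothness ℝ 3) G := lieGroup_minSmoothness I G
    exact leibniz_lie (x : GroupLieAlgebra I G) (y : GroupLieAlgebra I G) (z : GroupLieAlgebra I G)
  invariant := hG.inner_groupBracket I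

namespace IsNormalSubmersion

variable (hf : IsNormalSubmersion I I' f)
include hf

omit [FiniteDimensional ℝ E] [FiniteDimensional ℝ E'] [I'.Boundaryless]
  [IsContMDiffRiemannianBundle I ∞ E (fun x : G ↦ TangentSpace I x)] in
theorem fderiv_inCharts_chartField (p : G) {q : E} (hq : q ∈ (extChartAt I p).target)
    (hq' : f ((extChartAt I p).symm q) ∈ (extChartAt I' (f p)).source)
    (x : TangentSpace I (1 : G)) :
    fderiv ℝ (extChartAt I' (f p) ∘ f ∘ (extChartAt I p).symm) q
      (chartField I p (mulInvariantVectorField x) q) =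
    mfderiv I' 𝓘(ℝ, E') (extChartAt I' (f p)) (f ((extChartAt I p).symm q))
      (invariantImage I I' f ((extChartAt I p).symm q) x) := by
  have hs := (extChartAt I p).map_target hq
  have h1 := chartField_extChartAt I (mulInvariantVectorField x) hs
  have h2 := fderiv_inCharts I I' hs hq' (hf.submersion.1.contMDiffAt.of_le ENat.LEInfty.out)
    (mulInvariantVectorField x _)
  rw [(extChartAt I p).right_inv hq] at h1 h2
  rw [h1]
  exact h2

variable [IsContMDiffRiemannianBundle I' ∞ E' (fun x : B ↦ TangentSpace I' x)]

omit [IsContMDiffRiemannianBundle I ∞ E (fun x : G ↦ TangentSpace I x)]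
  [IsContMDiffRiemannianBundle I' ∞ E' (fun x : B ↦ TangentSpace I' x)] in
theorem isConstantFrame (p : G) :
    IsConstantFrame (chartMetric I' (f p)) (extChartAt I' (f p)).target
      (extChartAt I' (f p) ∘ f ∘ (extChartAt I p).symm)
      ((extChartAt I p).target ∩ (extChartAt I p).symm ⁻¹' (f ⁻¹' (extChartAt I' (f p)).source))
      (fun x : TangentSpace I (1 : G) ↦ chartField I p (mulInvariantVectorField x))
      (fun x y ↦ groupBracket I G x y)
      (fun x y ↦ inner ℝ (invariantImage I I' f 1 x) (invariantImage I I' f 1 y)) where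
  isOpen := (continuousOn_extChartAt_symm p).isOpen_inter_preimage (isOpen_extChartAt_target p)
    ((isOpen_extChartAt_source (f p)).preimage hf.submersion.1.continuous)
  mapsTo q hq := (extChartAt I' (f p)).map_source hq.2
  contDiffOn q hq := by
    have h := contDiffAt_inCharts I I' le_rfl ((extChartAt I p).map_target hq.1) hq.2
      hf.submersion.1.contMDiffAt
    rw [(extChartAt I p).right_inv hq.1] at h
    exact h.contDiffWithinAt
  contDiffOn_frame x q hq := by
    have : CompleteSpace E := FiniteDimensional.complete ℝ E
    have : LieGroup I (minSmoothness ℝ 3) G := lieGroup_minSmoothness I G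
    have h := contMDiffAt_mulInvariantVectorField (I := I) (G := G) x
      (g := (extChartAt I p).symm q)
    exact (contDiffAt_chartField I hq.1 (h.of_le le_minSmoothness)).contDiffWithinAt
  lieBracket_eq x y q hq := by
    have : CompleteSpace E := FiniteDimensional.complete ℝ E
    have : LieGroup I (minSmoothness ℝ 3) G := lieGroup_minSmoothness I G
    rw [groupBracket_apply, mulInvariantVector_mlieBracket]
    exact (chartField_mlieBracket I hq.1 (mdifferentiableAt_mulInvariantVectorField x)
      (mdifferentiableAt_mulInvariantVectorField y)).symm
  metric_eq x y q hq := by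
    rw [hf.fderiv_inCharts_chartField p hq.1 hq.2, hf.fderiv_inCharts_chartField p hq.1 hq.2,
      ← hf.inner_invariantImage ((extChartAt I p).symm q)]
    exact chartMetric_mfderiv I' hq.2 _ _
  surjective q hq u := by
    obtain ⟨w, hw⟩ := (isInvertible_mfderiv_extChartAt (I := I') hq.2).surjective u
    obtain ⟨x, rfl⟩ := hf.surjective _ w
    exact ⟨x, (hf.fderiv_inCharts_chartField p hq.1 hq.2 x).trans hw⟩

/-- The sectional curvature of the base in terms of horizontal lifts. -/
theorem inner_curvature_horizontal (p : G) {x y : TangentSpace I (1 : G)}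
    (hx : IsHorizontal I I' f x) (hy : IsHorizontal I I' f y) :
    inner ℝ (curvature I' (invariantImage I I' f p x) (invariantImage I I' f p y)
      (invariantImage I I' f p y)) (invariantImage I I' f p x) =
    inner ℝ (groupBracket I G x y) (groupBracket I G x y) - (3 / 4 : ℝ) *
      inner ℝ (invariantImage I I' f 1 (groupBracket I G x y))
        (invariantImage I I' f 1 (groupBracket I G x y)) := by
  have hbr := hf.biinvariant.isInvariantBracket
  have hinv := hbr.invariant
  have hskew := hbr.skew
  have hh : ∀ z w : TangentSpace I (1 : G), IsHorizontal I I' f w →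
      inner ℝ (invariantImage I I' f 1 z) (invariantImage I I' f 1 w) = inner ℝ z w := by
    intro z w hw
    rw [real_inner_comm, hf.inner_invariantImage_of_horizontal hw, real_inner_comm]
  have hsymm := (extChartAt I p).left_inv (mem_extChartAt_source p)
  have hq : extChartAt I p p ∈ (extChartAt I p).target ∩
      (extChartAt I p).symm ⁻¹' (f ⁻¹' (extChartAt I' (f p)).source) := by
    refine ⟨mem_extChartAt_target p, ?_⟩
    simp only [Set.mem_preimage, hsymm]
    exact mem_extChartAt_source (f p)
  have hyy : groupBracket I G y y = 0 := hbr.apply_self y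
  have hI : ∀ u v w : TangentSpace I (1 : G),
      inner ℝ (groupBracket I G u v) w = inner ℝ u (groupBracket I G v w) := by
    intro u v w
    rw [hskew, inner_neg_left, hinv, neg_neg]
  have key := (hf.isConstantFrame p).two_mul_metric_localCurvature (isMetricOn_chartMetric I' (f p))
    (x := x) (y := y) (z := y) (a := 0) (c := (1 / 2 : ℝ) • groupBracket I G x y)
    (fun w ↦ by
      simp only [map_zero, inner_zero_left]
      rw [show groupBracket I G y y = 0 from hyy, map_zero, inner_zero_left, hh _ _ hy, hh _ _ hy]
      rw [hskew w y, inner_neg_left, hinv y w y, hyy]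
      simp)
    (fun w ↦ by
      rw [hh _ _ hx, hh _ _ hy, map_smul, inner_smul_left, hI w y x, hskew x w, inner_neg_left,
        hI w x y, hskew y x, inner_neg_right]
      simp) x hq
  have hfd : ∀ x, fderiv ℝ (extChartAt I' (f p) ∘ f ∘ (extChartAt I p).symm) (extChartAt I p p)
      (chartField I p (mulInvariantVectorField x) (extChartAt I p p)) =
      toChart I' (f p) (invariantImage I I' f p x) := by
    intro x
    have h := hf.fderiv_inCharts_chartField p hq.1 hq.2 x
    have hc : ∀ p' : G, p' = p → (mfderiv I' 𝓘(ℝ, E') (extChartAt I' (f p)) (f p')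
      (invariantImage I I' f p' x) : E') = toChart I' (f p) (invariantImage I I' f p x) := by
      rintro _ rfl; rfl
    exact h.trans (hc _ hsymm)
  have hpt : (extChartAt I' (f p) ∘ f ∘ (extChartAt I p).symm) (extChartAt I p p) =
      extChartAt I' (f p) (f p) := by
    simp only [Function.comp_apply, hsymm]
  rw [hpt] at key
  simp only [hfd] at key
  rw [← inner_curvature] at key
  have e1 : inner ℝ (groupBracket I G y (groupBracket I G x y)) x =
      inner ℝ (groupBracket I G x y) (groupBracket I G x y) := by
    rw [hinv y, hskew y x, inner_neg_right, neg_neg]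
  have e2 := hinv x (groupBracket I G x y) y
  have e3 : inner ℝ (groupBracket I G (groupBracket I G x y) y) x =
      -inner ℝ (groupBracket I G x y) (groupBracket I G x y) := by
    rw [hI, hskew y x, inner_neg_right]
  have e4 := hI (groupBracket I G x y) x y
  simp only [map_zero, inner_zero_left, inner_zero_right, map_smul,
    inner_smul_left, inner_smul_right, hh _ _ hx, hh _ _ hy, e1, e2, e3, e4, hskew y x, map_neg,
    inner_neg_left, RCLike.conj_to_real] at key
  linarith

end IsNormalSubmersion

end Submersion

section Main

open Module

variable {E : Type*} [NormedAddCommGroup E] [NormedSpace ℝ E] [FiniteDimensional ℝ E]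
  {H : Type*} [TopologicalSpace H] {I : ModelWithCorners ℝ E H} [I.Boundaryless]
  {G : Type*} [TopologicalSpace G] [ChartedSpace H G] [Group G] [LieGroup I ∞ G]
  [RiemannianBundle (fun x : G ↦ TangentSpace I x)]
  [IsContMDiffRiemannianBundle I ∞ E (fun x : G ↦ TangentSpace I x)]

theorem IsBiinvariant.exists_finrank_ker_eq_lieRank (hG : IsBiinvariant I G) :
    ∃ x, finrank ℝ (LinearMap.ker (groupBracket I G x)) = lieRank I G := by
  have : CompleteSpace E := FiniteDimensional.complete ℝ E
  have : LieGroup I (minSmoothness ℝ 3) G := lieGroup_minSmoothness I G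
  have : FiniteDimensional ℝ (GroupLieAlgebra I G) := inferInstanceAs (FiniteDimensional ℝ E)
  exact exists_finrank_ker_ad_eq_rank (L := GroupLieAlgebra I G)
    fun x z h ↦ hG.isInvariantBracket.eq_zero_of_apply_apply_eq_zero h

theorem IsBiinvariant.lieRank_le_finrank_ker (hG : IsBiinvariant I G) (x : TangentSpace I (1 : G)) :
    lieRank I G ≤ finrank ℝ (LinearMap.ker (groupBracket I G x)) := by
  have : CompleteSpace E := FiniteDimensional.complete ℝ E
  have : LieGroup I (minSmoothness ℝ 3) G := lieGroup_minSmoothness I G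
  have : FiniteDimensional ℝ (GroupLieAlgebra I G) := inferInstanceAs (FiniteDimensional ℝ E)
  exact rank_le_finrank_ker_ad (L := GroupLieAlgebra I G)
    (fun x z h ↦ hG.isInvariantBracket.eq_zero_of_apply_apply_eq_zero h) x

/-- The rank of a simple Lie group with a bi-invariant metric is less than half of its
dimension. -/
theorem IsBiinvariant.two_mul_lieRank_lt (hG : IsBiinvariant I G) (hs : HasSimpleLieAlgebra I G) :
    2 * lieRank I G < finrank ℝ E := by
  have : CompleteSpace E := FiniteDimensional.complete ℝ E
  have : LieGroup I (minSmoothness ℝ 3) G := lieGroup_minSmoothness I G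
  have hs' : LieAlgebra.IsSimple ℝ (GroupLieAlgebra I G) := hs
  have hc : ∀ x, (∀ y, groupBracket I G x y = 0) → x = 0 := by
    intro x hx
    have h1 : LieAlgebra.center ℝ (GroupLieAlgebra I G) = ⊥ :=
      LieAlgebra.center_eq_bot _ _
    have h2 : (x : GroupLieAlgebra I G) ∈ LieAlgebra.center ℝ (GroupLieAlgebra I G) := by
      rw [LieModule.mem_maxTrivSubmodule]
      intro y
      rw [← lie_skew]
      exact neg_eq_zero.2 (hx y)
    rw [h1] at h2
    exact h2
  have hpos : 0 < finrank ℝ (TangentSpace I (1 : G)) := by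
    by_contra h0
    have h1 : Subsingleton (TangentSpace I (1 : G)) :=
      finrank_zero_iff.1 (Nat.eq_zero_of_not_pos h0)
    exact hs'.non_abelian ⟨fun x y ↦ h1.elim _ _⟩
  obtain ⟨x, hx⟩ := hG.isInvariantBracket.exists_two_mul_finrank_ker_lt hc hpos
  have h2 : finrank ℝ (TangentSpace I (1 : G)) = finrank ℝ E := rfl
  have h3 := hG.lieRank_le_finrank_ker x
  omega

variable {E' : Type*} [NormedAddCommGroup E'] [NormedSpace ℝ E'] [FiniteDimensional ℝ E']
  {H' : Type*} [TopologicalSpace H'] {I' : ModelWithCorners ℝ E' H'} [I'.Boundaryless]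
  {B : Type*} [TopologicalSpace B] [ChartedSpace H' B] [IsManifold I' ∞ B]
  {f : G → B}
  [RiemannianBundle (fun x : B ↦ TangentSpace I' x)]
  [IsContMDiffRiemannianBundle I' ∞ E' (fun x : B ↦ TangentSpace I' x)]

namespace IsNormalSubmersion

variable (hf : IsNormalSubmersion I I' f)
include hf

omit [IsContMDiffRiemannianBundle I ∞ E (fun x : G ↦ TangentSpace I x)]
  [IsContMDiffRiemannianBundle I' ∞ E' (fun x : B ↦ TangentSpace I' x)] in
omit [I'.Boundaryless] in
theorem inner_invariantImage_self_le (z : TangentSpace I (1 : G)) :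
    inner ℝ (invariantImage I I' f 1 z) (invariantImage I I' f 1 z) ≤ inner ℝ z z := by
  obtain ⟨y, hy, h⟩ := exists_horizontal I I' f z
  have h1 := (hf.eq_zero_iff 1 (z - y)).2 h
  rw [map_sub, sub_eq_zero] at h1
  rw [h1, hf.inner_invariantImage_of_horizontal hy]
  have h2 := hy (z - y) h
  have h3 : inner ℝ z z = inner ℝ y y + inner ℝ (z - y) (z - y) + 2 * inner ℝ y (z - y) := by
    simp only [inner_sub_left, inner_sub_right, real_inner_comm y z]
    ring
  have h4 : 0 ≤ inner ℝ (z - y) (z - y) := real_inner_self_nonneg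
  linarith

theorem inner_bracket_le_curvature (p : G) {x y : TangentSpace I (1 : G)}
    (hx : IsHorizontal I I' f x) (hy : IsHorizontal I I' f y) :
    (1 / 4 : ℝ) * inner ℝ (groupBracket I G x y) (groupBracket I G x y) ≤
    inner ℝ (curvature I' (invariantImage I I' f p x) (invariantImage I I' f p y)
      (invariantImage I I' f p y)) (invariantImage I I' f p x) := by
  rw [hf.inner_curvature_horizontal p hx hy]
  have := hf.inner_invariantImage_self_le (groupBracket I G x y)
  linarith

theorem h4_pos (hdim : 4 ≤ finrank ℝ E') (hrank : lieRank I G < (finrank ℝ E' + 1) / 2) (p : G) :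
    0 < h4 I' (f p) := by
  rw [h4_eq_weylInvariant]
  have hpos : ∀ u v : TangentSpace I' (f p), 0 ≤ (inner ℝ (curvature I' u v v) u : ℝ) := by
    intro u v
    obtain ⟨x, hx, rfl⟩ := hf.exists_lift p u
    obtain ⟨y, hy, rfl⟩ := hf.exists_lift p v
    have h1 := hf.inner_bracket_le_curvature p hx hy
    have h2 : 0 ≤ inner ℝ (groupBracket I G x y) (groupBracket I G x y) := real_inner_self_nonneg
    linarith
  refine ((isCurvatureLike_curvature I' (f p)).weylInvariant_pos_or hpos _).resolve_right ?_
  rintro ⟨e, S, hS, hK⟩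
  choose x hx hxe using fun i ↦ hf.exists_lift p (e i)
  have hcomm : ∀ i ∈ S, ∀ j ∈ S, groupBracket I G (x i) (x j) = 0 := by
    intro i hi j hj
    have h1 := hf.inner_bracket_le_curvature p (hx i) (hx j)
    rw [hxe, hxe, hK i hi j hj] at h1
    have h2 : 0 ≤ inner ℝ (groupBracket I G (x i) (x j)) (groupBracket I G (x i) (x j)) :=
      real_inner_self_nonneg
    exact inner_self_eq_zero.1 (le_antisymm (by linarith) h2)
  have hli : LinearIndependent ℝ x := by
    refine LinearIndependent.of_comp (invariantImage I I' f p).toLinearMap ?_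
    have : (invariantImage I I' f p).toLinearMap ∘ x = e := funext hxe
    rw [this]
    exact e.orthonormal.linearIndependent
  let a := Submodule.span ℝ (Set.range fun i : S ↦ x i)
  have ha : ∀ v ∈ a, ∀ w ∈ a, groupBracket I G v w = 0 := by
    intro v hv w hw
    induction hv, hw using Submodule.span_induction₂ with
    | mem_mem v w hv hw =>
      obtain ⟨i, rfl⟩ := hv
      obtain ⟨j, rfl⟩ := hw
      exact hcomm i i.2 j j.2
    | zero_left w hw => simp
    | zero_right v hv => simp
    | add_left u v w _ _ _ h1 h2 => simp [h1, h2]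
    | add_right u v w _ _ _ h1 h2 => simp [h1, h2]
    | smul_left c v w _ _ h => simp [h]
    | smul_right c v w _ _ h => simp [h]
  have hfr : finrank ℝ a = S.card := by
    have := finrank_span_eq_card (hli.comp (fun i : S ↦ (i : Fin _)) Subtype.val_injective)
    rw [Fintype.card_coe] at this
    exact this
  obtain ⟨y, hy⟩ := hf.biinvariant.exists_finrank_ker_eq_lieRank
  have h1 := hf.biinvariant.isInvariantBracket.finrank_le_finrank_ker a ha y
  have h2 : finrank ℝ (TangentSpace I' (f p)) = finrank ℝ E' := rfl
  omega

end IsNormalSubmersion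

omit [I.Boundaryless] [FiniteDimensional ℝ E] [LieGroup I ∞ G]
  [IsContMDiffRiemannianBundle I ∞ E (fun x : G ↦ TangentSpace I x)] in
theorem IsBiinvariant.isNormalSubmersion_id (hG : IsBiinvariant I G) :
    IsNormalSubmersion I I (id : G → G) where
  biinvariant := hG
  submersion := by
    refine ⟨contMDiff_id, fun x v ↦ ⟨v, ?_⟩, fun x v w _ _ ↦ ?_⟩
    · rw [mfderiv_id]; rfl
    · rw [mfderiv_id]; rfl
  fibres a x h := by
    change a * x = a
    rw [show x = 1 from h, mul_one]

end Main

end SecondWeyl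

end

theorem mainTheorem8
    {E : Type*} [NormedAddCommGroup E] [NormedSpace ℝ E] [FiniteDimensional ℝ E]
    {H : Type*} [TopologicalSpace H] (I : ModelWithCorners ℝ E H) [I.Boundaryless]
    (G : Type*) [TopologicalSpace G] [ChartedSpace H G] [Group G] [LieGroup I ∞ G]
    [RiemannianBundle (fun x : G ↦ TangentSpace I x)]
    [IsContMDiffRiemannianBundle I ∞ E (fun x : G ↦ TangentSpace I x)]
    (hG : SecondWeyl.IsBiinvariant I G) :
    (CompactSpace G → ConnectedSpace G → 4 ≤ Module.finrank ℝ E →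
      (SecondWeyl.lieRank I G < (Module.finrank ℝ E + 1) / 2 →
        ∀ x : G, 0 < SecondWeyl.h4 I x) ∧
      (SecondWeyl.HasSimpleLieAlgebra I G →
        SecondWeyl.lieRank I G < (Module.finrank ℝ E + 1) / 2 ∧
        ∀ x : G, 0 < SecondWeyl.h4 I x)) ∧
    (∀ (K : Subgroup G), IsClosed (K : Set G) →
      ∀ (E' : Type*) [NormedAddCommGroup E'] [NormedSpace ℝ E'] [FiniteDimensional ℝ E']
        (H' : Type*) [TopologicalSpace H'] (I' : ModelWithCorners ℝ E' H') [I'.Boundaryless]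
        [ChartedSpace H' (G ⧸ K)] [IsManifold I' ∞ (G ⧸ K)]
        [RiemannianBundle (fun x : G ⧸ K ↦ TangentSpace I' x)]
        [IsContMDiffRiemannianBundle I' ∞ E' (fun x : G ⧸ K ↦ TangentSpace I' x)],
        SecondWeyl.IsRiemannianSubmersion I I' (QuotientGroup.mk : G → G ⧸ K) →
        4 ≤ Module.finrank ℝ E' →
        SecondWeyl.lieRank I G < (Module.finrank ℝ E' + 1) / 2 →
        ∀ x : G ⧸ K, 0 < SecondWeyl.h4 I' x) := by
  refine ⟨fun _ _ hdim ↦ ?_, ?_⟩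
  · have h1 := fun hr ↦ hG.isNormalSubmersion_id.h4_pos hdim hr
    refine ⟨h1, fun hs ↦ ?_⟩
    have hr : SecondWeyl.lieRank I G < (Module.finrank ℝ E + 1) / 2 := by
      have := hG.two_mul_lieRank_lt hs
      omega
    exact ⟨hr, h1 hr⟩
  · intro K _ E' _ _ _ H' _ I' _ _ _ _ _ hf hdim hr x
    obtain ⟨p, rfl⟩ := QuotientGroup.mk_surjective x
    refine SecondWeyl.IsNormalSubmersion.h4_pos ⟨hG, hf, fun a x h ↦ ?_⟩ hdim hr p
    rw [QuotientGroup.eq] at h ⊢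
    simpa using h
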